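/- For an integer $d\ge 4$, call a $C^2$ function $u\ge 0$ on $(1,\infty)$ a nonnegative solution if $$u''(r)+\frac{d-1}{r}\,u'(r)=4u(r)^2\qquad (r>1).$$ There is a (unique) maximal nonnegative solution $u_1=u_{1,d}$, that is, a nonnegative solution with $v\le u_1$ on $(1,\infty)$ for every nonnegative solution $v$. It has the following properties. (i) If $d\ge 5$, there are constants $a_0,b_0,b_1'>0$ depending only on $d$ such that $\lim_{r\to\infty} r^{d-2}u_1(r)=a_0$, and $$u_1(r)\ge a_0\,r^{2-d}\quad (r>1),\qquad u_1(r)\le b_0\,r^{2-d}\quad\text{and}\quad u_1(r)\le a_0\,r^{2-d}+b_1'\,r^{6-2d}\quad (r\ge 4/3).$$ (ii) If $d=4$, then $\lim_{r\to\infty} r^{2}\log(r)\,u_1(r)=\tfrac12$, and $$u_1(r)\ge \frac{1}{2r^2\log(2r)}\quad (r>1);$$ there is a constant $b_0>0$ such that $$u_1(r)\le \frac{b_0}{2r^2\log r}\quad (r\ge 4/3);$$ and for every $\rho>e$ there is a constant $b_1'>0$, depending only on $\rho$, such that $$u_1(r)\le \frac{1}{2r^2\log r}+\frac{b_1'\,\log(\log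 r)}{r^2(\log r)^2}\quad (r\ge\rho).$$ -/

import Mathlib

open Set Filter Topology

/-- `u` is a nonnegative classical (`C²`) solution on `(1, ∞)` of
`u'' + ((d - 1) / r) u' = 4 u²`. Only the values of `u` on `(1, ∞)` matter. -/
structure IsNonnegSolution (d : ℕ) (u : ℝ → ℝ) : Prop where
  contDiffOn : ContDiffOn ℝ 2 u (Ioi 1)
  nonneg : ∀ r : ℝ, 1 < r → 0 ≤ u r
  ode : ∀ r : ℝ, 1 < r →
    deriv (deriv u) r + ((d : ℝ) - 1) / r * deriv u r = 4 * u r ^ 2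

/-- `u` is the maximal nonnegative solution on `(1, ∞)`: a nonnegative solution that dominates
every nonnegative solution. Two such functions agree on `(1, ∞)`. -/
structure IsMaximalNonnegSolution (d : ℕ) (u : ℝ → ℝ) : Prop where
  isNonnegSolution : IsNonnegSolution d u
  le_of_isNonnegSolution : ∀ v : ℝ → ℝ, IsNonnegSolution d v → ∀ r : ℝ, 1 < r → v r ≤ u r

/-! With the flux `h = (d - 2) v + r v'` the equation becomes `h' = 4 r v²`, while `(r^(d-2) v)' =
r^(d-3) h`. Solutions vanish at infinity (`IsNonnegSolution.le_div_sq`, the Keller–Osserman bound).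
Hence `h` increases to `0` from below, and `r^(d-2) v` decreases to a limit.

Existence: comparison makes the nonnegative solutions totally ordered (`IsNonnegSolution.le_total`).
The difference of two ordered solutions is again subharmonic and so decreasing. A solution close to
the supremum at one point is therefore at least as close further out, and its flux is controlled
too. This lets the first-order system pass to the limit (`supNonnegSolution_isFluxPair`), so the
pointwise supremum is a solution.

Lower bounds: since `u₁` dominates every solution, it is enough to place a solution above an
explicit subsolution (`exists_isNonnegSolution_ge`). Subtracting `2 d u / r²` from both sides turns
the equation into a fixed-point problem for an integral operator that is order preserving below
`r⁻²` when `d ≥ 4`, and Knaster–Tarski applies. One subsolution gives positivity of `u₁`; another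
gives the bound with `log (2 r)` when `d = 4`.

For `d ≥ 5`, put `m = r^(d-2) u`. Integrating the system twice from infinity gives `m ≤ a + M²
r^(4-d)` (`IsFluxPair.pow_mul_le_add`); the same inequality rules out `a = 0` for a positive
solution (`IsFluxPair.limit_pos`).

For `d = 4`, put `m = r² u`. Comparing `-h` with `2 m² / r²` and its next correction gives `(1/m)' ≥
(2 - 4 m) / r`. Using it once yields `m = O(1 / log r)`. Feeding that back yields `1/m ≥ 2 log r -
O(log log r)` (`IsFluxPair.four_eventually_le`), which matches the lower bound to leading order. -/

/-- `v` is a nonnegative solution written as the first-order system for `v` and the flux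
`h = (d - 2) v + r * deriv v`. -/
structure IsFluxPair (d : ℕ) (v h : ℝ → ℝ) : Prop where
  nonneg : ∀ r : ℝ, 1 < r → 0 ≤ v r
  hasDerivAt : ∀ r : ℝ, 1 < r → HasDerivAt v ((h r - ((d : ℝ) - 2) * v r) / r) r
  hasDerivAt_flux : ∀ r : ℝ, 1 < r → HasDerivAt h (4 * r * v r ^ 2) r

/-! ### Equivalence of the equation with the first-order system -/

theorem IsNonnegSolution.hasDerivAt {d : ℕ} {v : ℝ → ℝ} (hv : IsNonnegSolution d v) {r : ℝ}
    (hr : 1 < r) : HasDerivAt v (deriv v r) r :=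
  ((hv.contDiffOn.differentiableOn (by norm_num)).differentiableAt (Ioi_mem_nhds hr)).hasDerivAt

theorem IsNonnegSolution.hasDerivAt_deriv {d : ℕ} {v : ℝ → ℝ} (hv : IsNonnegSolution d v) {r : ℝ}
    (hr : 1 < r) :
    HasDerivAt (deriv v) (4 * v r ^ 2 - ((d : ℝ) - 1) / r * deriv v r) r := by
  have h1 : ContDiffOn ℝ 1 (deriv v) (Ioi 1) :=
    ((contDiffOn_succ_iff_deriv_of_isOpen (n := 1) isOpen_Ioi).1
      (by simpa [one_add_one_eq_two] using hv.contDiffOn)).2.2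
  have h2 := ((h1.differentiableOn (by norm_num)).differentiableAt (Ioi_mem_nhds hr)).hasDerivAt
  have h3 := hv.ode r hr
  rwa [show 4 * v r ^ 2 - ((d : ℝ) - 1) / r * deriv v r = deriv (deriv v) r by linarith]

theorem IsNonnegSolution.isFluxPair {d : ℕ} {v : ℝ → ℝ} (hv : IsNonnegSolution d v) :
    IsFluxPair d v (fun r => ((d : ℝ) - 2) * v r + r * deriv v r) where
  nonneg := hv.nonneg
  hasDerivAt r hr := by
    have hr0 : r ≠ 0 := by positivity
    refine (hv.hasDerivAt hr).congr_deriv ?_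
    field_simp
    ring
  hasDerivAt_flux r hr := by
    have hr0 : r ≠ 0 := by positivity
    have := ((hv.hasDerivAt hr).const_mul ((d : ℝ) - 2)).add
      ((hasDerivAt_id r).mul (hv.hasDerivAt_deriv hr))
    refine this.congr_deriv ?_
    simp only [id]
    field_simp
    ring

theorem IsFluxPair.isNonnegSolution {d : ℕ} {v h : ℝ → ℝ} (hv : IsFluxPair d v h) :
    IsNonnegSolution d v := by
  have hd : ∀ r ∈ Ioi (1 : ℝ), deriv v r = (h r - ((d : ℝ) - 2) * v r) / r :=
    fun r hr => (hv.hasDerivAt r hr).deriv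
  have hdd : ∀ r ∈ Ioi (1 : ℝ), HasDerivAt (deriv v)
      (4 * v r ^ 2 - ((d : ℝ) - 1) / r * ((h r - ((d : ℝ) - 2) * v r) / r)) r := by
    intro r hr
    have hr0 : r ≠ 0 := by have : (1 : ℝ) < r := hr; positivity
    have h1 := ((hv.hasDerivAt_flux r hr).sub
      ((hv.hasDerivAt r hr).const_mul ((d : ℝ) - 2))).div (hasDerivAt_id r) hr0
    have h2 := h1.congr_of_eventuallyEq (f₁ := deriv v)
      (Filter.eventuallyEq_of_mem (Ioi_mem_nhds hr) hd)
    refine h2.congr_deriv ?_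
    simp only [id, Pi.sub_apply]
    field_simp
    ring
  have cv : ContinuousOn v (Ioi 1) := fun r hr => (hv.hasDerivAt r hr).continuousAt.continuousWithinAt
  have ch : ContinuousOn h (Ioi 1) :=
    fun r hr => (hv.hasDerivAt_flux r hr).continuousAt.continuousWithinAt
  refine ⟨?_, hv.nonneg, fun r hr => ?_⟩
  · rw [← one_add_one_eq_two, contDiffOn_succ_iff_deriv_of_isOpen isOpen_Ioi]
    refine ⟨fun r hr => (hv.hasDerivAt r hr).differentiableAt.differentiableWithinAt, by simp, ?_⟩
    rw [← zero_add 1, contDiffOn_succ_iff_deriv_of_isOpen isOpen_Ioi]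
    refine ⟨fun r hr => (hdd r hr).differentiableAt.differentiableWithinAt, by simp, ?_⟩
    rw [contDiffOn_zero]
    refine ContinuousOn.congr ?_ (fun r hr => (hdd r hr).deriv)
    have : ∀ r ∈ Ioi (1 : ℝ), r ≠ 0 := fun r hr => by
      have : (1 : ℝ) < r := hr
      positivity
    fun_prop (disch := assumption)
  · rw [(hdd r hr).deriv, hd r hr]
    ring

/-! ### Minimum principle and the Keller–Osserman bound -/

/-- At an interior minimum a function cannot satisfy an inequality of the form `L D < 0` with `L` elliptic. -/
theorem not_isLocalMin_of_deriv_deriv_add_neg {D D' : ℝ → ℝ} {x D'' c : ℝ}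
    (hD : ∀ᶠ y in 𝓝 x, HasDerivAt D (D' y) y) (hD' : HasDerivAt D' D'' x)
    (hneg : D'' + c * D' x < 0) : ¬ IsLocalMin D x := by
  intro hmin
  have h0 : D' x = 0 := hmin.hasDerivAt_eq_zero hD.self_of_nhds
  have hderiv : deriv D =ᶠ[𝓝 x] D' := hD.mono fun y hy => hy.deriv
  have hdd : deriv (deriv D) x = D'' := by rw [hderiv.deriv_eq, hD'.deriv]
  have hmax : IsLocalMax D x := isLocalMax_of_deriv_deriv_neg (by rw [hdd]; simpa [h0] using hneg)
    (by rw [hderiv.self_of_nhds, h0]) hD.self_of_nhds.continuousAt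
  have hconst : D =ᶠ[𝓝 x] fun _ => D x := by
    filter_upwards [hmin, hmax] with y h1 h2 using le_antisymm h2 h1
  have h2 : deriv (deriv D) x = 0 := by
    have := hconst.deriv
    rw [this.deriv_eq]
    simp
  rw [hdd] at h2
  rw [h2, h0] at hneg
  simp at hneg

/-- Minimum principle: a continuous function on an open set which is asymptotically nonnegative at
the boundary and has no negative local minimum is nonnegative. -/
theorem nonneg_of_forall_not_isLocalMin {I : Set ℝ} (hI : IsOpen I) {D : ℝ → ℝ}
    (hD : ContinuousOn D I)
    (hbd : ∀ ε > 0, ∃ K ⊆ I, IsCompact K ∧ ∀ x ∈ I, x ∉ K → -ε ≤ D x)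
    (hmin : ∀ x ∈ I, D x < 0 → ¬ IsLocalMin D x) : ∀ x ∈ I, 0 ≤ D x := by
  intro x hx
  by_contra! hneg
  obtain ⟨K, hKI, hK, hout⟩ := hbd (-D x / 2) (by linarith)
  have hxK : x ∈ K := by
    by_contra hxK
    have := hout x hx hxK
    linarith
  obtain ⟨y, hyK, hy⟩ := hK.exists_isMinOn ⟨x, hxK⟩ (hD.mono hKI)
  have hyx : D y ≤ D x := hy hxK
  refine hmin y (hKI hyK) (by linarith) ?_
  filter_upwards [hI.mem_nhds (hKI hyK)] with z hz
  by_cases hzK : z ∈ K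
  · exact hy hzK
  · have := hout z hz hzK
    linarith

theorem hasDerivAt_barrier (A : ℝ) {e r z : ℝ} (hz : e ^ 2 - (z - r) ^ 2 ≠ 0) :
    HasDerivAt (fun z => A * ((e ^ 2 - (z - r) ^ 2) ^ 2)⁻¹)
      (4 * A * (z - r) * ((e ^ 2 - (z - r) ^ 2) ^ 3)⁻¹) z := by
  have h1 := ((((hasDerivAt_id z).sub_const r).pow 2).const_sub (e ^ 2)).pow 2
  refine ((h1.inv (pow_ne_zero 2 hz)).const_mul A).congr_deriv ?_
  simp only [id, Pi.pow_apply]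
  field_simp
  ring

theorem hasDerivAt_deriv_barrier (A : ℝ) {e r z : ℝ} (hz : e ^ 2 - (z - r) ^ 2 ≠ 0) :
    HasDerivAt (fun z => 4 * A * (z - r) * ((e ^ 2 - (z - r) ^ 2) ^ 3)⁻¹)
      (4 * A * ((e ^ 2 - (z - r) ^ 2) ^ 3)⁻¹ +
        24 * A * (z - r) ^ 2 * ((e ^ 2 - (z - r) ^ 2) ^ 4)⁻¹) z := by
  have h1 := ((((hasDerivAt_id z).sub_const r).pow 2).const_sub (e ^ 2)).pow 3
  refine ((((hasDerivAt_id z).sub_const r).const_mul (4 * A)).mul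
    (h1.inv (pow_ne_zero 3 hz))).congr_deriv ?_
  simp only [id, Pi.pow_apply, Pi.inv_apply]
  field_simp
  ring

/-- The exponent 2 in the barrier makes its second derivative and its square scale alike, as `q⁻⁴`.
With `q = e² - x²`, `c = d - 1` and `x / y ≤ 1`, the last factor is at most `(d + 6) e² - A`, so a
large `A` contradicts contact with a solution. -/
theorem barrier_residual_eq {A q x w p c y : ℝ} (hq : q ≠ 0) (hw : w = A * (q ^ 2)⁻¹) :
    (4 * A * (q ^ 3)⁻¹ + 24 * A * x ^ 2 * (q ^ 4)⁻¹) - (4 * w ^ 2 - c / y * p) +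
        c / y * (4 * A * x * (q ^ 3)⁻¹ - p) =
      4 * A * (q ^ 4)⁻¹ * (q + 6 * x ^ 2 + c * (x / y) * q - A) := by
  rw [hw]
  field_simp
  ring

/-- Keller–Osserman bound. -/
theorem IsNonnegSolution.le_div_sq {d : ℕ} (hd : 1 ≤ d) {v : ℝ → ℝ} (hv : IsNonnegSolution d v)
    {r : ℝ} (hr : 1 < r) : v r ≤ 4 * ((d : ℝ) + 6) / (r - 1) ^ 2 := by
  set e : ℝ := (r - 1) / 2 with he
  have he0 : 0 < e := by rw [he]; linarith
  -- The weight vanishes at both endpoints, so a positive maximum of the weighted function is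
  -- attained in the interior.
  have hcont : ContinuousOn (fun x => (e ^ 2 - (x - r) ^ 2) ^ 2 * v x) (Icc (r - e) (r + e)) := by
    refine ContinuousOn.mul (by fun_prop) (hv.contDiffOn.continuousOn.mono ?_)
    intro x hx
    have := hx.1
    simp only [mem_Ioi]
    linarith
  obtain ⟨y, hy, hymax⟩ := isCompact_Icc.exists_isMaxOn
    (⟨r, by constructor <;> linarith⟩ : (Icc (r - e) (r + e)).Nonempty) hcont
  have hyr : e ^ 4 * v r ≤ (e ^ 2 - (y - r) ^ 2) ^ 2 * v y := by
    have := hymax (show r ∈ Icc (r - e) (r + e) by constructor <;> linarith)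
    simp only [mem_ofPred_eq] at this
    nlinarith [this]
  have hy1 : 1 < y := by linarith [hy.1]
  set x := y - r with hx
  have hvr := hv.nonneg r hr
  rcases hvr.eq_or_lt with h0 | hpos
  · rw [← h0]; positivity
  have hprod : 0 < (e ^ 2 - x ^ 2) ^ 2 * v y := lt_of_lt_of_le (by positivity) hyr
  have hvy : 0 < v y := by
    rcases (hv.nonneg y hy1).eq_or_lt with h | h
    · rw [← h] at hprod; simp at hprod
    · exact h
  have hxe : |x| ≤ e := abs_le.2 ⟨by linarith [hy.1], by linarith [hy.2]⟩
  have hq : 0 < e ^ 2 - x ^ 2 := by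
    rcases (sub_nonneg.2 (sq_le_sq' (by linarith [(abs_le.1 hxe).1]) (abs_le.1 hxe).2)).eq_or_lt
      with h | h
    · rw [← h] at hprod; simp at hprod
    · exact h
  set A := (e ^ 2 - x ^ 2) ^ 2 * v y with hA
  -- the barrier `A / (e² - (z - r)²)²` touches `v` from above at `y`
  have hopen : ∀ᶠ z in 𝓝 y, 0 < e ^ 2 - (z - r) ^ 2 := by
    have : ContinuousAt (fun z => e ^ 2 - (z - r) ^ 2) y := by fun_prop
    exact this.eventually (lt_mem_nhds hq)
  have hloc : IsLocalMin (fun z => A * ((e ^ 2 - (z - r) ^ 2) ^ 2)⁻¹ - v z) y := by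
    have hIcc : ∀ᶠ z in 𝓝 y, z ∈ Icc (r - e) (r + e) := by
      filter_upwards [hopen] with z hz
      have := abs_lt_of_sq_lt_sq (show (z - r) ^ 2 < e ^ 2 by linarith) he0.le
      rw [abs_lt] at this
      constructor <;> linarith
    filter_upwards [hopen, hIcc] with z hz hzI
    have h1 : (e ^ 2 - (z - r) ^ 2) ^ 2 * v z ≤ A := hymax hzI
    have h2 : A * ((e ^ 2 - (y - r) ^ 2) ^ 2)⁻¹ - v y = 0 := by
      rw [← hx, hA]; field_simp; ring
    rw [h2]
    have h3 : v z ≤ A * ((e ^ 2 - (z - r) ^ 2) ^ 2)⁻¹ := by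
      rw [← div_eq_mul_inv, le_div_iff₀ (by positivity)]; linarith
    linarith
  by_contra! hlt
  have hAbig : ((d : ℝ) + 6) * e ^ 2 < A := by
    have h1 : (r - 1) ^ 2 = 4 * e ^ 2 := by rw [he]; ring
    rw [h1, div_lt_iff₀ (by positivity)] at hlt
    have : ((d : ℝ) + 6) < v r * e ^ 2 := by linarith
    nlinarith [mul_lt_mul_of_pos_right this (pow_pos he0 2)]
  have hD : ∀ᶠ z in 𝓝 y, HasDerivAt (fun z => A * ((e ^ 2 - (z - r) ^ 2) ^ 2)⁻¹ - v z)
      (4 * A * (z - r) * ((e ^ 2 - (z - r) ^ 2) ^ 3)⁻¹ - deriv v z) z := by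
    filter_upwards [hopen, Ioi_mem_nhds hy1] with z hz hz1
    exact (hasDerivAt_barrier A hz.ne').sub (hv.hasDerivAt hz1)
  have hD' := (hasDerivAt_deriv_barrier A (e := e) (r := r) hq.ne').sub (hv.hasDerivAt_deriv hy1)
  refine not_isLocalMin_of_deriv_deriv_add_neg (c := ((d : ℝ) - 1) / y) hD hD' ?_ hloc
  have hvA : v y = A * ((e ^ 2 - x ^ 2) ^ 2)⁻¹ := by rw [hA]; field_simp
  have hApos : 0 < A := hprod
  have hd' : (1 : ℝ) ≤ d := by exact_mod_cast hd
  have hxy : x / y ≤ 1 := by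
    rw [div_le_one (by linarith)]
    linarith [(abs_le.1 hxe).2]
  refine (barrier_residual_eq hq.ne' hvA).trans_lt (mul_neg_of_pos_of_neg (by positivity) ?_)
  have h5 : ((d : ℝ) - 1) * (x / y) ≤ (d : ℝ) - 1 := by nlinarith
  have h6 := mul_le_mul_of_nonneg_right h5 hq.le
  have h7 : 0 ≤ ((d : ℝ) - 1) * x ^ 2 := mul_nonneg (by linarith) (sq_nonneg _)
  nlinarith [sq_nonneg x]

theorem IsNonnegSolution.tendsto_zero {d : ℕ} (hd : 1 ≤ d) {v : ℝ → ℝ}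
    (hv : IsNonnegSolution d v) : Tendsto v atTop (𝓝 0) := by
  have h1 : Tendsto (fun r : ℝ => 4 * ((d : ℝ) + 6) / (r - 1) ^ 2) atTop (𝓝 0) :=
    tendsto_const_nhds.div_atTop
      ((tendsto_pow_atTop two_ne_zero).comp (tendsto_atTop_add_const_right _ (-1) tendsto_id))
  refine tendsto_of_tendsto_of_tendsto_of_le_of_le' tendsto_const_nhds h1 ?_ ?_
  · filter_upwards [eventually_gt_atTop 1] with r hr using hv.nonneg r hr
  · filter_upwards [eventually_gt_atTop 1] with r hr using hv.le_div_sq hd hr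

/-! ### Monotonicity and behaviour at infinity -/

theorem monotoneOn_Ioi_of_hasDerivAt_nonneg {f f' : ℝ → ℝ} {a : ℝ}
    (hf : ∀ x, a < x → HasDerivAt f (f' x) x) (h0 : ∀ x, a < x → 0 ≤ f' x) :
    MonotoneOn f (Ioi a) := by
  refine monotoneOn_of_deriv_nonneg (convex_Ioi a)
    (fun x hx => (hf x hx).continuousAt.continuousWithinAt) ?_ ?_ <;> rw [interior_Ioi]
  · exact fun x hx => (hf x hx).differentiableAt.differentiableWithinAt
  · exact fun x hx => by rw [(hf x hx).deriv]; exact h0 x hx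

theorem antitoneOn_Ioi_of_hasDerivAt_nonpos {f f' : ℝ → ℝ} {a : ℝ}
    (hf : ∀ x, a < x → HasDerivAt f (f' x) x) (h0 : ∀ x, a < x → f' x ≤ 0) :
    AntitoneOn f (Ioi a) := by
  have := monotoneOn_Ioi_of_hasDerivAt_nonneg (fun x hx => (hf x hx).neg)
    (fun x hx => neg_nonneg.2 (h0 x hx))
  intro x hx y hy hxy
  have := this hx hy hxy
  simpa using this

theorem nonpos_of_hasDerivAt_nonneg_of_tendsto {f f' : ℝ → ℝ} {a : ℝ}
    (hf : ∀ x, a < x → HasDerivAt f (f' x) x) (h0 : ∀ x, a < x → 0 ≤ f' x)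
    (hlim : Tendsto f atTop (𝓝 0)) {x : ℝ} (hx : a < x) : f x ≤ 0 := by
  refine ge_of_tendsto hlim ?_
  filter_upwards [eventually_ge_atTop x] with y hy
  exact monotoneOn_Ioi_of_hasDerivAt_nonneg hf h0 hx (lt_of_lt_of_le hx hy) hy

theorem nonneg_of_hasDerivAt_nonpos_of_tendsto {f f' : ℝ → ℝ} {a : ℝ}
    (hf : ∀ x, a < x → HasDerivAt f (f' x) x) (h0 : ∀ x, a < x → f' x ≤ 0)
    (hlim : Tendsto f atTop (𝓝 0)) {x : ℝ} (hx : a < x) : 0 ≤ f x := by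
  refine le_of_tendsto hlim ?_
  filter_upwards [eventually_ge_atTop x] with y hy
  exact antitoneOn_Ioi_of_hasDerivAt_nonpos hf h0 hx (lt_of_lt_of_le hx hy) hy

/-- The integral of `1 / x` diverges, so `f - c log` being nondecreasing forces growth. Used below
to contradict the existence of finite limits. -/
theorem tendsto_atTop_of_div_le_hasDerivAt {f f' : ℝ → ℝ} {c : ℝ} (hc : 0 < c)
    (hf : ∀ᶠ x in atTop, HasDerivAt f (f' x) x) (h0 : ∀ᶠ x in atTop, c / x ≤ f' x) :
    Tendsto f atTop atTop := by
  obtain ⟨b, hb⟩ := eventually_atTop.1 ((hf.and h0).and (eventually_gt_atTop 0))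
  have hmono : MonotoneOn (fun x => f x - c * Real.log x) (Ioi b) := by
    refine monotoneOn_Ioi_of_hasDerivAt_nonneg (f' := fun x => f' x - c * x⁻¹) (fun x hx => ?_)
      (fun x hx => ?_)
    · exact (hb x hx.le).1.1.sub ((Real.hasDerivAt_log (hb x hx.le).2.ne').const_mul c)
    · have := (hb x hx.le).1.2
      rw [div_eq_mul_inv] at this
      linarith
  have hlog : Tendsto (fun x => f (b + 1) - c * Real.log (b + 1) + c * Real.log x) atTop atTop :=
    tendsto_atTop_add_const_left _ _ (Real.tendsto_log_atTop.const_mul_atTop hc)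
  refine tendsto_atTop_mono' _ ?_ hlog
  filter_upwards [eventually_ge_atTop (b + 1)] with x hx
  have := hmono (show b < b + 1 by linarith) (show b < x by linarith) hx
  simp only at this
  linarith

/-! ### Radial subharmonic functions vanishing at infinity -/

/-- The radial part of a nonnegative subharmonic function vanishing at infinity, as a first-order
system: `h = (d - 2) v + r * deriv v` and `deriv h = g ≥ 0`. -/
structure IsSubharmonicPair (d : ℕ) (v h g : ℝ → ℝ) : Prop where
  nonneg : ∀ r : ℝ, 1 < r → 0 ≤ v r
  hasDerivAt : ∀ r : ℝ, 1 < r → HasDerivAt v ((h r - ((d : ℝ) - 2) * v r) / r) r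
  hasDerivAt_flux : ∀ r : ℝ, 1 < r → HasDerivAt h (g r) r
  source_nonneg : ∀ r : ℝ, 1 < r → 0 ≤ g r
  tendsto_zero : Tendsto v atTop (𝓝 0)

namespace IsSubharmonicPair

variable {d : ℕ} {v h g : ℝ → ℝ}

theorem flux_monotoneOn (H : IsSubharmonicPair d v h g) : MonotoneOn h (Ioi 1) :=
  monotoneOn_Ioi_of_hasDerivAt_nonneg H.hasDerivAt_flux H.source_nonneg

/-- A positive flux value persists by monotonicity, and since `(d - 2) v → 0` it would make `v` grow
logarithmically. -/
theorem flux_nonpos (H : IsSubharmonicPair d v h g) {r : ℝ} (hr : 1 < r) : h r ≤ 0 := by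
  by_contra! hpos
  have h1 : Tendsto (fun x => ((d : ℝ) - 2) * v x) atTop (𝓝 0) := by
    simpa using H.tendsto_zero.const_mul ((d : ℝ) - 2)
  refine not_tendsto_nhds_of_tendsto_atTop (tendsto_atTop_of_div_le_hasDerivAt
    (half_pos hpos) (f := v) (f' := fun x => (h x - ((d : ℝ) - 2) * v x) / x) ?_ ?_) 0
    H.tendsto_zero
  · filter_upwards [eventually_gt_atTop 1] with x hx using H.hasDerivAt x hx
  · filter_upwards [eventually_ge_atTop r, h1.eventually_le_const (half_pos hpos)] with x hx hx2
    have hx1 : 1 < x := lt_of_lt_of_le hr hx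
    have := H.flux_monotoneOn hr hx1 hx
    gcongr
    linarith

/-- If the increasing flux stayed below some `-ε`, then `v' ≤ -ε / r` and `v` would tend to `-∞`. -/
theorem flux_tendsto_zero (hd : 2 ≤ d) (H : IsSubharmonicPair d v h g) :
    Tendsto h atTop (𝓝 0) := by
  have hd' : (2 : ℝ) ≤ d := by exact_mod_cast hd
  rw [Metric.tendsto_atTop]
  intro ε hε
  by_cases hex : ∃ r, 1 < r ∧ -ε < h r
  · obtain ⟨r, hr, hrε⟩ := hex
    refine ⟨r, fun x hx => ?_⟩
    have hx1 : 1 < x := lt_of_lt_of_le hr hx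
    have := H.flux_monotoneOn hr hx1 hx
    rw [Real.dist_eq, sub_zero, abs_lt]
    exact ⟨by linarith, by linarith [H.flux_nonpos hx1]⟩
  · push Not at hex
    exfalso
    have hneg : Tendsto (fun x => -v x) atTop (𝓝 0) := by simpa using H.tendsto_zero.neg
    refine not_tendsto_nhds_of_tendsto_atTop (tendsto_atTop_of_div_le_hasDerivAt
      hε (f := fun x => -v x) (f' := fun x => -((h x - ((d : ℝ) - 2) * v x) / x)) ?_ ?_) 0 hneg
    · filter_upwards [eventually_gt_atTop 1] with x hx using (H.hasDerivAt x hx).neg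
    · filter_upwards [eventually_gt_atTop 1] with x hx
      rw [← neg_div]
      have := hex x hx
      have := mul_nonneg (sub_nonneg.2 hd') (H.nonneg x hx)
      gcongr
      linarith

theorem antitoneOn (hd : 2 ≤ d) (H : IsSubharmonicPair d v h g) : AntitoneOn v (Ioi 1) := by
  have hd' : (2 : ℝ) ≤ d := by exact_mod_cast hd
  refine antitoneOn_Ioi_of_hasDerivAt_nonpos H.hasDerivAt fun x hx => ?_
  have := mul_nonneg (sub_nonneg.2 hd') (H.nonneg x hx)
  exact div_nonpos_of_nonpos_of_nonneg (by linarith [H.flux_nonpos hx]) (by linarith)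

theorem hasDerivAt_pow_mul {k : ℕ} (H : IsSubharmonicPair (k + 2) v h g) {r : ℝ} (hr : 1 < r) :
    HasDerivAt (fun r => r ^ k * v r) (r ^ k * h r / r) r := by
  have hr0 : r ≠ 0 := by positivity
  refine ((hasDerivAt_pow k r).mul (H.hasDerivAt r hr)).congr_deriv ?_
  rcases k with _ | k
  · simp
  · push_cast
    rw [add_tsub_cancel_right]
    field_simp
    ring

theorem antitoneOn_pow_mul {k : ℕ} (H : IsSubharmonicPair (k + 2) v h g) :
    AntitoneOn (fun r => r ^ k * v r) (Ioi 1) := by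
  refine antitoneOn_Ioi_of_hasDerivAt_nonpos (fun x hx => H.hasDerivAt_pow_mul hx) fun x hx => ?_
  have hx0 : 0 < x := by linarith
  exact div_nonpos_of_nonpos_of_nonneg
    (mul_nonpos_of_nonneg_of_nonpos (by positivity) (H.flux_nonpos hx)) hx0.le

/-- The flux is controlled by the values of the function further inside. -/
theorem neg_flux_le (hd : 2 ≤ d) (H : IsSubharmonicPair d v h g) {a b r : ℝ} (ha : 1 < a)
    (hab : a < b) (hbr : b ≤ r) : -h r ≤ b / (b - a) * v a := by
  have hd' : (2 : ℝ) ≤ d := by exact_mod_cast hd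
  -- The mean value theorem bounds the flux at one point of `(a, b)` through the drop of `v`;
  -- monotonicity of the flux carries the bound out to `r`.
  obtain ⟨x, hx, hxs⟩ := exists_hasDerivAt_eq_slope v
    (fun r => (h r - ((d : ℝ) - 2) * v r) / r) hab
    (fun y hy => (H.hasDerivAt y (lt_of_lt_of_le ha hy.1)).continuousAt.continuousWithinAt)
    (fun y hy => H.hasDerivAt y (ha.trans hy.1))
  have hx1 : 1 < x := ha.trans hx.1
  have h1 : h x ≤ h r := H.flux_monotoneOn hx1 (hx1.trans (hx.2.trans_le hbr)) (hx.2.le.trans hbr)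
  have h2 := mul_nonneg (sub_nonneg.2 hd') (H.nonneg x hx1)
  have hvb := H.nonneg b (ha.trans hab)
  have hva := H.nonneg a ha
  have hba : 0 < b - a := sub_pos.2 hab
  have h3 : -h x ≤ x * (v a - v b) / (b - a) := by
    have hx0 : x ≠ 0 := by positivity
    have : h x - ((d : ℝ) - 2) * v x = x * ((v b - v a) / (b - a)) := by
      rw [← hxs]; field_simp
    have e : x * (v a - v b) / (b - a) = -(x * ((v b - v a) / (b - a))) := by ring
    rw [e, ← this]
    linarith
  have h4 : x * (v a - v b) / (b - a) ≤ b / (b - a) * v a := by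
    rw [div_mul_eq_mul_div]
    have hvab := H.antitoneOn hd ha (ha.trans hab) hab.le
    gcongr
    · linarith
    · exact hx.2.le
    · linarith
  linarith

end IsSubharmonicPair

theorem IsFluxPair.isSubharmonicPair {d : ℕ} (hd : 1 ≤ d) {v h : ℝ → ℝ} (H : IsFluxPair d v h) :
    IsSubharmonicPair d v h (fun r => 4 * r * v r ^ 2) where
  nonneg := H.nonneg
  hasDerivAt := H.hasDerivAt
  hasDerivAt_flux := H.hasDerivAt_flux
  source_nonneg r hr := by
    have : 0 < r := by linarith
    positivity
  tendsto_zero := H.isNonnegSolution.tendsto_zero hd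

/-- The system is linear apart from its source, and the source is increasing on nonnegative values.
-/
theorem IsFluxPair.sub_isSubharmonicPair {d : ℕ} (hd : 1 ≤ d) {v h w k : ℝ → ℝ}
    (Hv : IsFluxPair d v h) (Hw : IsFluxPair d w k) (hle : ∀ r, 1 < r → w r ≤ v r) :
    IsSubharmonicPair d (fun r => v r - w r) (fun r => h r - k r)
      (fun r => 4 * r * (v r ^ 2 - w r ^ 2)) where
  nonneg r hr := sub_nonneg.2 (hle r hr)
  hasDerivAt r hr := ((Hv.hasDerivAt r hr).sub (Hw.hasDerivAt r hr)).congr_deriv (by ring)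
  hasDerivAt_flux r hr :=
    ((Hv.hasDerivAt_flux r hr).sub (Hw.hasDerivAt_flux r hr)).congr_deriv (by ring)
  source_nonneg r hr := by
    have h1 : w r ^ 2 ≤ v r ^ 2 := pow_le_pow_left₀ (Hw.nonneg r hr) (hle r hr) 2
    have h2 : 0 ≤ v r ^ 2 - w r ^ 2 := sub_nonneg.2 h1
    have : 0 < r := by linarith
    positivity
  tendsto_zero := by
    simpa using (Hv.isNonnegSolution.tendsto_zero hd).sub (Hw.isNonnegSolution.tendsto_zero hd)

/-! ### Comparison and total ordering of solutions -/

/-- A solution that is larger at one point is at least as large further out. -/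
theorem IsNonnegSolution.le_of_lt_of_le {d : ℕ} (hd : 1 ≤ d) {v w : ℝ → ℝ}
    (hv : IsNonnegSolution d v) (hw : IsNonnegSolution d w) {a r : ℝ} (ha : 1 < a)
    (hlt : w a < v a) (har : a ≤ r) : w r ≤ v r := by
  rcases har.eq_or_lt with rfl | har
  · exact hlt.le
  have hI : ∀ x ∈ Ioi a, 1 < x := fun x hx => ha.trans hx
  have hc : ContinuousOn (fun x => v x - w x) (Ioi 1) :=
    hv.contDiffOn.continuousOn.sub hw.contDiffOn.continuousOn
  have key := nonneg_of_forall_not_isLocalMin (D := fun x => v x - w x) (isOpen_Ioi (a := a))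
    (hc.mono hI) ?_ ?_ r har
  · simpa using key
  · intro ε hε
    have h1 : ∀ᶠ x in 𝓝 a, 0 < v x - w x :=
      (hc.continuousAt (Ioi_mem_nhds ha)).eventually (lt_mem_nhds (sub_pos.2 hlt))
    obtain ⟨b, hab, hb⟩ := exists_Ico_subset_of_mem_nhds h1 (exists_gt a)
    have h2 : Tendsto (fun x => v x - w x) atTop (𝓝 0) := by
      simpa using (hv.tendsto_zero hd).sub (hw.tendsto_zero hd)
    obtain ⟨c, hc⟩ := eventually_atTop.1 (h2.eventually_const_le (neg_lt_zero.2 hε))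
    refine ⟨Icc b c, fun x hx => lt_of_lt_of_le hab hx.1, isCompact_Icc, fun x hx hxK => ?_⟩
    rcases lt_or_ge x b with h | h
    · have : 0 < v x - w x := hb ⟨le_of_lt hx, h⟩
      linarith
    · refine hc x ?_
      by_contra! h'
      exact hxK ⟨h, h'.le⟩
  · intro x hx hneg
    have hx1 := hI x hx
    refine not_isLocalMin_of_deriv_deriv_add_neg (c := ((d : ℝ) - 1) / x) ?_
      ((hv.hasDerivAt_deriv hx1).sub (hw.hasDerivAt_deriv hx1)) ?_
    · filter_upwards [Ioi_mem_nhds hx1] with y hy using (hv.hasDerivAt hy).sub (hw.hasDerivAt hy)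
    · have h1 := hv.nonneg x hx1
      have h2 := hw.nonneg x hx1
      simp only [Pi.sub_apply]
      -- Where `v < w` with `v ≥ 0`, the sum `v + w` is positive, so the operator applied to `v - w`
      -- gives the strictly negative value `4 (v - w) (v + w)`.
      have h3 : (v x - w x) * (v x + w x) < 0 := mul_neg_of_neg_of_pos hneg (by linarith)
      nlinarith

/-- Nonnegative solutions are totally ordered. -/
theorem IsNonnegSolution.le_total {d : ℕ} (hd : 1 ≤ d) {v w : ℝ → ℝ}
    (hv : IsNonnegSolution d v) (hw : IsNonnegSolution d w) :
    (∀ r, 1 < r → w r ≤ v r) ∨ (∀ r, 1 < r → v r ≤ w r) := by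
  by_contra! hcon
  obtain ⟨⟨a, ha, hva⟩, ⟨b, hb, hvb⟩⟩ := hcon
  rcases le_or_gt a b with h | h
  · exact absurd (hw.le_of_lt_of_le hd hv ha hva h) (not_le.2 hvb)
  · exact absurd (hv.le_of_lt_of_le hd hw hb hvb h.le) (not_le.2 hva)

theorem isNonnegSolution_zero (d : ℕ) : IsNonnegSolution d (fun _ => 0) where
  contDiffOn := contDiffOn_const
  nonneg _ _ := le_rfl
  ode r _ := by simp

/-! ### The maximal solution as a supremum -/

/-- The pointwise supremum of all nonnegative solutions. -/
noncomputable def supNonnegSolution (d : ℕ) (r : ℝ) : ℝ :=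
  ⨆ v : {v : ℝ → ℝ // IsNonnegSolution d v}, v.1 r

theorem bddAbove_range_nonnegSolution {d : ℕ} (hd : 1 ≤ d) {r : ℝ} (hr : 1 < r) :
    BddAbove (range fun v : {v : ℝ → ℝ // IsNonnegSolution d v} => v.1 r) := by
  refine ⟨4 * ((d : ℝ) + 6) / (r - 1) ^ 2, ?_⟩
  rintro _ ⟨v, rfl⟩
  exact v.2.le_div_sq hd hr

theorem IsNonnegSolution.le_supNonnegSolution {d : ℕ} (hd : 1 ≤ d) {v : ℝ → ℝ}
    (hv : IsNonnegSolution d v) {r : ℝ} (hr : 1 < r) : v r ≤ supNonnegSolution d r :=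
  le_ciSup (bddAbove_range_nonnegSolution hd hr) ⟨v, hv⟩

theorem supNonnegSolution_le {d : ℕ} {r C : ℝ} (h : ∀ v, IsNonnegSolution d v → v r ≤ C) :
    supNonnegSolution d r ≤ C := by
  have : Nonempty {v : ℝ → ℝ // IsNonnegSolution d v} := ⟨⟨_, isNonnegSolution_zero d⟩⟩
  exact ciSup_le fun v => h v.1 v.2

/-- An approximation of the supremum at one point is at least as good further out. -/
theorem IsNonnegSolution.supNonnegSolution_sub_le {d : ℕ} (hd : 2 ≤ d) {V : ℝ → ℝ}
    (hV : IsNonnegSolution d V) {a r : ℝ} (ha : 1 < a) (har : a ≤ r) :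
    supNonnegSolution d r - V r ≤ supNonnegSolution d a - V a := by
  have hd1 : 1 ≤ d := by omega
  rw [sub_le_iff_le_add]
  refine supNonnegSolution_le fun v hv => ?_
  have h1 := hV.le_supNonnegSolution hd1 ha
  rcases hv.le_total hd1 hV with h | h
  · have h2 := (hv.isFluxPair.sub_isSubharmonicPair hd1 hV.isFluxPair h).antitoneOn hd ha
      (ha.trans_le har) har
    linarith [hv.le_supNonnegSolution hd1 ha]
  · linarith [h r (ha.trans_le har)]

/-- Total ordering lets the flux estimate be applied to the difference in whichever order is
nonnegative. -/
theorem abs_flux_sub_le {d : ℕ} (hd : 2 ≤ d) {v h w k : ℝ → ℝ} (Hv : IsFluxPair d v h)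
    (Hw : IsFluxPair d w k) {a b r : ℝ} (ha : 1 < a) (hab : a < b) (hbr : b ≤ r) :
    |h r - k r| ≤ b / (b - a) * |v a - w a| := by
  have hd1 : 1 ≤ d := by omega
  have hr : 1 < r := ha.trans (hab.trans_le hbr)
  wlog hle : ∀ r, 1 < r → w r ≤ v r generalizing v h w k
  · rw [abs_sub_comm, abs_sub_comm (v a)]
    exact this Hw Hv
      ((Hv.isNonnegSolution.le_total hd1 Hw.isNonnegSolution).resolve_left hle)
  have H := Hv.sub_isSubharmonicPair hd1 Hw hle
  have h1 := H.neg_flux_le hd ha hab hbr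
  have h2 := H.flux_nonpos hr
  rw [abs_of_nonpos h2, abs_of_nonneg (H.nonneg a ha)]
  exact h1

theorem tendstoUniformlyOn_of_abs_sub_le {f : ℕ → ℝ → ℝ} {g : ℝ → ℝ} {s : Set ℝ} {e : ℕ → ℝ}
    (he : Tendsto e atTop (𝓝 0)) (h : ∀ᶠ n in atTop, ∀ x ∈ s, |f n x - g x| ≤ e n) :
    TendstoUniformlyOn f g atTop s := by
  rw [Metric.tendstoUniformlyOn_iff]
  intro ε hε
  filter_upwards [h, he.eventually_lt_const hε] with n hn hn2 x hx
  rw [dist_comm, Real.dist_eq]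
  exact (hn x hx).trans_lt hn2

/-- Near-optimality is imposed only at `1 + 1/(n+1)`. These points tend to `1`, so the gap at any
fixed `a > 1` is eventually controlled from further inside. -/
theorem exists_seq_tendsto_supNonnegSolution {d : ℕ} (hd : 2 ≤ d) :
    ∃ V : ℕ → ℝ → ℝ, (∀ n, IsNonnegSolution d (V n)) ∧
      ∀ a, 1 < a → Tendsto (fun n => supNonnegSolution d a - V n a) atTop (𝓝 0) := by
  have hd1 : 1 ≤ d := by omega
  have : Nonempty {v : ℝ → ℝ // IsNonnegSolution d v} := ⟨⟨_, isNonnegSolution_zero d⟩⟩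
  have hex : ∀ n : ℕ, ∃ v, IsNonnegSolution d v ∧
      supNonnegSolution d (1 + 1 / ((n : ℝ) + 1)) - 1 / ((n : ℝ) + 1) <
        v (1 + 1 / ((n : ℝ) + 1)) := by
    intro n
    have hpos : (0 : ℝ) < 1 / ((n : ℝ) + 1) := by positivity
    obtain ⟨v, hv⟩ := exists_lt_of_lt_ciSup (sub_lt_self
      (supNonnegSolution d (1 + 1 / ((n : ℝ) + 1))) hpos)
    exact ⟨v.1, v.2, hv⟩
  choose V hV hVlt using hex
  refine ⟨V, hV, fun a ha => ?_⟩
  have hlim := tendsto_one_div_add_atTop_nhds_zero_nat (𝕜 := ℝ)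
  refine tendsto_of_tendsto_of_tendsto_of_le_of_le' tendsto_const_nhds hlim ?_ ?_
  · exact Eventually.of_forall fun n => sub_nonneg.2 ((hV n).le_supNonnegSolution hd1 ha)
  · filter_upwards [hlim.eventually_lt_const (sub_pos.2 ha)] with n hn
    have hpos : (0 : ℝ) < 1 / ((n : ℝ) + 1) := by positivity
    have := (hV n).supNonnegSolution_sub_le hd (a := 1 + 1 / ((n : ℝ) + 1)) (r := a)
      (by linarith) (by linarith)
    linarith [hVlt n]

theorem supNonnegSolution_isFluxPair {d : ℕ} (hd : 2 ≤ d) :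
    ∃ H, IsFluxPair d (supNonnegSolution d) H := by
  have hd1 : 1 ≤ d := by omega
  have hd' : (2 : ℝ) ≤ d := by exact_mod_cast hd
  obtain ⟨V, hV, hlim⟩ := exists_seq_tendsto_supNonnegSolution hd
  set u := supNonnegSolution d with hu
  have hVlim : ∀ a, 1 < a → Tendsto (fun n => V n a) atTop (𝓝 (u a)) := fun a ha => by
    simpa using (hlim a ha).const_sub (u a)
  have hVu : ∀ n a, 1 < a → |V n a - u a| = u a - V n a := fun n a ha => by
    rw [abs_sub_comm, abs_of_nonneg (sub_nonneg.2 ((hV n).le_supNonnegSolution hd1 ha))]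
  obtain ⟨h, hh⟩ : ∃ h : ℕ → ℝ → ℝ, ∀ n, IsFluxPair d (V n) (h n) :=
    ⟨_, fun n => (hV n).isFluxPair⟩
  -- The condition `1 < r` sits inside the existential so that `choose` returns a limit flux on all
  -- of `ℝ`; its values outside `(1, ∞)` play no role.
  have hcau : ∀ r : ℝ, ∃ L, 1 < r → Tendsto (fun n => h n r) atTop (𝓝 L) := by
    intro r
    by_cases hr : 1 < r
    · obtain ⟨a, ha, har⟩ := exists_between hr
      have hc : CauchySeq fun n => r / (r - a) * V n a :=
        ((hVlim a ha).const_mul _).cauchySeq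
      have : CauchySeq fun n => h n r := by
        rw [Metric.cauchySeq_iff] at hc ⊢
        intro ε hε
        obtain ⟨N, hN⟩ := hc ε hε
        refine ⟨N, fun m hm n hn => lt_of_le_of_lt ?_ (hN m hm n hn)⟩
        rw [Real.dist_eq, Real.dist_eq, ← mul_sub, abs_mul,
          abs_of_pos (div_pos (by linarith) (sub_pos.2 har))]
        exact abs_flux_sub_le hd (hh m) (hh n) ha har le_rfl
      obtain ⟨L, hL⟩ := cauchySeq_tendsto_of_complete this
      exact ⟨L, fun _ => hL⟩
    · exact ⟨0, fun h => absurd h hr⟩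
  choose H hH using hcau
  have hflux : ∀ n (a b r : ℝ), 1 < a → a < b → b ≤ r →
      |h n r - H r| ≤ b / (b - a) * (u a - V n a) := by
    intro n a b r ha hab hbr
    have hr : 1 < r := ha.trans (hab.trans_le hbr)
    have h1 : Tendsto (fun m => |h n r - h m r|) atTop (𝓝 |h n r - H r|) :=
      ((hH r hr).const_sub _).abs
    have h2 : Tendsto (fun m => b / (b - a) * |V n a - V m a|) atTop
        (𝓝 (b / (b - a) * |V n a - u a|)) :=
      (((hVlim a ha).const_sub _).abs).const_mul _
    rw [← hVu n a ha]
    exact le_of_tendsto_of_tendsto' h1 h2 fun m =>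
      abs_flux_sub_le hd (hh n) (hh m) ha hab hbr
  refine ⟨H, fun r hr => ((isNonnegSolution_zero d).le_supNonnegSolution hd1 hr),
    fun r hr => ?_, fun r hr => ?_⟩
  · obtain ⟨b, hb, hbr⟩ := exists_between hr
    obtain ⟨a, ha, hab⟩ := exists_between hb
    refine hasDerivAt_of_tendstoUniformlyOn (l := atTop) (isOpen_Ioi (a := b)) (f := V)
      (f' := fun n x => (h n x - ((d : ℝ) - 2) * V n x) / x) (g := u)
      (g' := fun x => (H x - ((d : ℝ) - 2) * u x) / x) ?_
      (Eventually.of_forall fun n x hx => (hh n).hasDerivAt x (hb.trans hx))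
      (fun x hx => hVlim x (hb.trans hx)) hbr
    refine tendstoUniformlyOn_of_abs_sub_le
      (e := fun n => (b / (b - a) + ((d : ℝ) - 2)) * (u a - V n a))
      (by simpa using (hlim a ha).const_mul _) (Eventually.of_forall fun n x hx => ?_)
    have hx1 : 1 < x := hb.trans hx
    have e : (h n x - ((d : ℝ) - 2) * V n x) / x - (H x - ((d : ℝ) - 2) * u x) / x =
        ((h n x - H x) - ((d : ℝ) - 2) * (V n x - u x)) / x := by ring
    rw [e, abs_div, abs_of_pos (show 0 < x by linarith), div_le_iff₀ (by linarith)]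
    have h1 := hflux n a b x ha hab (le_of_lt hx)
    have h2 : |V n x - u x| ≤ u a - V n a := by
      rw [hVu n x hx1]
      exact (hV n).supNonnegSolution_sub_le hd ha (hab.le.trans (le_of_lt hx))
    have h3 : |h n x - H x - ((d : ℝ) - 2) * (V n x - u x)| ≤
        |h n x - H x| + ((d : ℝ) - 2) * |V n x - u x| := by
      refine (abs_sub _ _).trans ?_
      rw [abs_mul, abs_of_nonneg (sub_nonneg.2 hd')]
    have h4 := mul_le_mul_of_nonneg_left h2 (sub_nonneg.2 hd')
    have h5 : (b / (b - a) + ((d : ℝ) - 2)) * (u a - V n a) ≤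
        (b / (b - a) + ((d : ℝ) - 2)) * (u a - V n a) * x := by
      refine le_mul_of_one_le_right (mul_nonneg ?_ ((abs_nonneg _).trans h2)) hx1.le
      have : 0 < b / (b - a) := div_pos (by linarith) (sub_pos.2 hab)
      linarith
    linarith
  · obtain ⟨b, hb, hbr⟩ := exists_between hr
    obtain ⟨c, hc⟩ := exists_gt r
    refine hasDerivAt_of_tendstoUniformlyOn (l := atTop) (isOpen_Ioo (a := b) (b := c)) (f := h)
      (f' := fun n x => 4 * x * V n x ^ 2) (g := H) (g' := fun x => 4 * x * u x ^ 2) ?_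
      (Eventually.of_forall fun n x hx => (hh n).hasDerivAt_flux x (hb.trans hx.1))
      (fun x hx => hH x (hb.trans hx.1)) ⟨hbr, hc⟩
    -- The Keller–Osserman bound at `b` bounds all solutions on `(b, c)`, where squaring is then
    -- uniformly Lipschitz.
    set M := 4 * ((d : ℝ) + 6) / (b - 1) ^ 2 with hM
    have hM0 : 0 ≤ M := by positivity
    refine tendstoUniformlyOn_of_abs_sub_le (e := fun n => (4 * c * (2 * M)) * (u b - V n b))
      (by simpa using (hlim b hb).const_mul _) (Eventually.of_forall fun n x hx => ?_)
    have hx1 : 1 < x := hb.trans hx.1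
    have hKO : u x ≤ M := supNonnegSolution_le fun v hv => by
      refine (hv.le_div_sq hd1 hx1).trans ?_
      have := hx.1
      have : 0 < b - 1 := by linarith
      rw [hM]
      gcongr
    have hVx : V n x ≤ u x := (hV n).le_supNonnegSolution hd1 hx1
    have hV0 := (hV n).nonneg x hx1
    have h1 : |V n x - u x| ≤ u b - V n b := by
      rw [hVu n x hx1]
      exact (hV n).supNonnegSolution_sub_le hd hb hx.1.le
    have e : 4 * x * V n x ^ 2 - 4 * x * u x ^ 2 = 4 * x * (V n x + u x) * (V n x - u x) := by
      ring
    have hx0 : 0 < x := by linarith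
    have hsum : 0 ≤ V n x + u x := by linarith
    have hc0 : 0 ≤ c := by linarith
    have hxc := hx.2.le
    rw [e, abs_mul, abs_of_nonneg (by positivity)]
    gcongr
    linarith

theorem exists_isMaximalNonnegSolution {d : ℕ} (hd : 2 ≤ d) :
    ∃ u, IsMaximalNonnegSolution d u := by
  obtain ⟨H, hH⟩ := supNonnegSolution_isFluxPair hd
  exact ⟨_, hH.isNonnegSolution, fun v hv r hr => hv.le_supNonnegSolution (by omega) hr⟩

theorem IsMaximalNonnegSolution.eq {d : ℕ} {u v : ℝ → ℝ} (hu : IsMaximalNonnegSolution d u)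
    (hv : IsMaximalNonnegSolution d v) {r : ℝ} (hr : 1 < r) : u r = v r :=
  le_antisymm (hv.le_of_isNonnegSolution u hu.isNonnegSolution r hr)
    (hu.le_of_isNonnegSolution v hv.isNonnegSolution r hr)

/-! ### Solutions above subsolutions by a monotone integral operator -/

/-- The source term of the linearly shifted equation, increasing in `u ∈ [0, x⁻²]`. -/
noncomputable def greenSource (d : ℕ) (u : ℝ → ℝ) (x : ℝ) : ℝ :=
  2 * d * u x / x ^ 3 - 4 * u x ^ 2 / x

/-- The shifted operator `u'' + (d-1)/r u' - 2 d u / r²` has homogeneous solutions `r²` and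
`r^(-d)`. It factors as `r (r^(-d-1) (r^d u)')'`. This is the integration from infinity that inverts
the outer factor. -/
noncomputable def greenInner (d : ℕ) (u : ℝ → ℝ) (s : ℝ) : ℝ :=
  ∫ x in Ioi s, greenSource d u x

/-- The order-preserving integral operator whose fixed points solve the equation with `u 1 = B`. -/
noncomputable def greenOp (d : ℕ) (B : ℝ) (u : ℝ → ℝ) (r : ℝ) : ℝ :=
  (B + ∫ s in (1 : ℝ)..r, s ^ (d + 1) * greenInner d u s) / r ^ d

/-- Monotonicity of `r^d u` is there for measurability: unlike measurability itself, it survives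
suprema of arbitrary families. -/
structure IsAdmissible (d : ℕ) (u : ℝ → ℝ) : Prop where
  monotoneOn : MonotoneOn (fun r => r ^ d * u r) (Ici 1)
  nonneg : ∀ r : ℝ, 1 ≤ r → 0 ≤ u r
  le : ∀ r : ℝ, 1 ≤ r → u r ≤ 1 / r ^ 2

/-- The slope in `u` is `2 d / x³ - 8 u / x`, which is nonnegative for `u ≤ x⁻²` exactly because `d
≥ 4`. -/
theorem greenSource_le_greenSource {d : ℕ} (hd : 4 ≤ d) {u w : ℝ → ℝ} {x : ℝ} (hx : 1 ≤ x)
    (huw : u x ≤ w x) (hw : w x ≤ 1 / x ^ 2) : greenSource d u x ≤ greenSource d w x := by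
  have hd' : (4 : ℝ) ≤ d := by exact_mod_cast hd
  have hx0 : 0 < x := by linarith
  have e : greenSource d w x - greenSource d u x =
      (w x - u x) / x * (2 * d * (1 / x ^ 2) - 4 * (w x + u x)) := by
    unfold greenSource
    field_simp
    ring
  have h1 : 0 ≤ (w x - u x) / x := div_nonneg (sub_nonneg.2 huw) hx0.le
  have h2 : 0 ≤ 1 / x ^ 2 := by positivity
  have h3 : 0 ≤ 2 * d * (1 / x ^ 2) - 4 * (w x + u x) := by nlinarith
  nlinarith [mul_nonneg h1 h3]

theorem greenSource_nonneg {d : ℕ} (hd : 4 ≤ d) {u : ℝ → ℝ} {x : ℝ} (hx : 1 ≤ x)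
    (h0 : 0 ≤ u x) (hu : u x ≤ 1 / x ^ 2) : 0 ≤ greenSource d u x := by
  have := greenSource_le_greenSource hd (u := fun _ => 0) hx h0 hu
  simpa [greenSource] using this

theorem greenSource_le {d : ℕ} (hd : 4 ≤ d) {u : ℝ → ℝ} {x : ℝ} (hx : 1 ≤ x)
    (hu : u x ≤ 1 / x ^ 2) : greenSource d u x ≤ (2 * d - 4) * x ^ (-5 : ℝ) := by
  have hx0 : 0 < x := by linarith
  refine (greenSource_le_greenSource hd (w := fun x => 1 / x ^ 2) hx hu le_rfl).trans_eq ?_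
  unfold greenSource
  rw [Real.rpow_neg hx0.le, show (5 : ℝ) = ((5 : ℕ) : ℝ) by norm_num, Real.rpow_natCast]
  field_simp

namespace IsAdmissible

open MeasureTheory

variable {d : ℕ} {u w : ℝ → ℝ}

theorem aemeasurable (hu : IsAdmissible d u) : AEMeasurable u (volume.restrict (Ioi 1)) := by
  have h1 : AEMeasurable (fun r => r ^ d * u r) (volume.restrict (Ioi (1 : ℝ))) :=
    (aemeasurable_restrict_of_monotoneOn measurableSet_Ici hu.monotoneOn).mono_measure
      (Measure.restrict_mono Ioi_subset_Ici_self le_rfl)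
  have h2 : AEMeasurable (fun r => (r ^ d * u r) / r ^ d) (volume.restrict (Ioi (1 : ℝ))) :=
    h1.div (measurable_id.pow_const d).aemeasurable
  refine h2.congr ?_
  filter_upwards [ae_restrict_mem measurableSet_Ioi] with x hx
  have : x ≠ 0 := by have : (1 : ℝ) < x := hx; positivity
  field_simp

theorem integrableOn_greenSource (hd : 4 ≤ d) (hu : IsAdmissible d u) {s : ℝ} (hs : 1 ≤ s) :
    IntegrableOn (greenSource d u) (Ioi s) := by
  refine IntegrableOn.mono_set ?_ (Ioi_subset_Ioi hs)
  refine Integrable.mono' (g := fun x => (2 * d - 4) * x ^ (-5 : ℝ))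
    ((integrableOn_Ioi_rpow_of_lt (by norm_num) one_pos).const_mul _) ?_ ?_
  · have := hu.aemeasurable
    unfold greenSource
    have h3 : AEMeasurable (fun x : ℝ => x ^ 3) (volume.restrict (Ioi 1)) := by fun_prop
    exact (((this.const_mul (2 * (d : ℝ))).div h3).sub
      (((this.pow_const 2).const_mul 4).div aemeasurable_id)).aestronglyMeasurable
  · filter_upwards [ae_restrict_mem measurableSet_Ioi] with x hx
    have hx1 : 1 ≤ x := le_of_lt hx
    rw [Real.norm_eq_abs, abs_of_nonneg (greenSource_nonneg hd hx1 (hu.nonneg x hx1) (hu.le x hx1))]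
    exact greenSource_le hd hx1 (hu.le x hx1)

theorem greenInner_nonneg (hd : 4 ≤ d) (hu : IsAdmissible d u) {s : ℝ} (hs : 1 ≤ s) :
    0 ≤ greenInner d u s := by
  refine setIntegral_nonneg measurableSet_Ioi fun x hx => ?_
  have hx1 : 1 ≤ x := hs.trans (le_of_lt hx)
  exact greenSource_nonneg hd hx1 (hu.nonneg x hx1) (hu.le x hx1)

theorem greenInner_le (hd : 4 ≤ d) (hu : IsAdmissible d u) {s : ℝ} (hs : 1 ≤ s) :
    greenInner d u s ≤ ((d : ℝ) - 2) / 2 / s ^ 4 := by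
  have hs0 : 0 < s := by linarith
  have h1 : greenInner d u s ≤ ∫ x in Ioi s, (2 * d - 4) * x ^ (-5 : ℝ) := by
    refine setIntegral_mono_on (hu.integrableOn_greenSource hd hs)
      ((integrableOn_Ioi_rpow_of_lt (by norm_num) hs0).const_mul _) measurableSet_Ioi fun x hx => ?_
    have hx1 : 1 ≤ x := hs.trans (le_of_lt hx)
    exact greenSource_le hd hx1 (hu.le x hx1)
  refine h1.trans_eq ?_
  rw [integral_const_mul, integral_Ioi_rpow_of_lt (by norm_num) hs0,
    show (-5 : ℝ) + 1 = -((4 : ℕ) : ℝ) by norm_num, Real.rpow_neg hs0.le, Real.rpow_natCast]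
  field_simp
  norm_num
  ring

theorem greenInner_mono (hd : 4 ≤ d) (hu : IsAdmissible d u) (hw : IsAdmissible d w)
    (huw : ∀ r, 1 ≤ r → u r ≤ w r) {s : ℝ} (hs : 1 ≤ s) :
    greenInner d u s ≤ greenInner d w s := by
  refine setIntegral_mono_on (hu.integrableOn_greenSource hd hs)
    (hw.integrableOn_greenSource hd hs) measurableSet_Ioi fun x hx => ?_
  have hx1 : 1 ≤ x := hs.trans (le_of_lt hx)
  exact greenSource_le_greenSource hd hx1 (huw x hx1) (hw.le x hx1)

theorem greenInner_eq (hd : 4 ≤ d) (hu : IsAdmissible d u) {s : ℝ} (hs : 1 ≤ s) :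
    greenInner d u s = greenInner d u 1 - ∫ x in (1 : ℝ)..s, greenSource d u x := by
  rw [← intervalIntegral.integral_Ioi_sub_Ioi (hu.integrableOn_greenSource hd le_rfl) hs]
  simp [greenInner]

theorem intervalIntegrable_greenSource (hd : 4 ≤ d) (hu : IsAdmissible d u) {s : ℝ}
    (hs : 1 ≤ s) : IntervalIntegrable (greenSource d u) volume 1 s := by
  rw [intervalIntegrable_iff_integrableOn_Ioc_of_le hs]
  exact (hu.integrableOn_greenSource hd le_rfl).mono_set Ioc_subset_Ioi_self

theorem continuousOn_greenInner (hd : 4 ≤ d) (hu : IsAdmissible d u) (R : ℝ) :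
    ContinuousOn (greenInner d u) (Icc 1 R) := by
  rcases lt_or_ge R 1 with hR | hR
  · simp [Icc_eq_empty (not_le.2 hR)]
  have h1 := intervalIntegral.continuousOn_primitive_interval'
    (hu.intervalIntegrable_greenSource hd hR) (a := 1) (by simp)
  rw [uIcc_of_le hR] at h1
  exact (continuousOn_const.sub h1).congr fun s hs => hu.greenInner_eq hd hs.1

theorem intervalIntegrable_weight (hd : 4 ≤ d) (hu : IsAdmissible d u) {a b : ℝ} (ha : 1 ≤ a)
    (hab : a ≤ b) : IntervalIntegrable (fun s => s ^ (d + 1) * greenInner d u s) volume a b := by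
  refine ContinuousOn.intervalIntegrable ?_
  rw [uIcc_of_le hab]
  exact (by fun_prop : ContinuousOn (fun s : ℝ => s ^ (d + 1)) (Icc a b)).mul
    ((hu.continuousOn_greenInner hd b).mono (Icc_subset_Icc_left ha))

theorem greenOp_mono (hd : 4 ≤ d) (B : ℝ) (hu : IsAdmissible d u) (hw : IsAdmissible d w)
    (huw : ∀ r, 1 ≤ r → u r ≤ w r) {r : ℝ} (hr : 1 ≤ r) :
    greenOp d B u r ≤ greenOp d B w r := by
  unfold greenOp
  have hr0 : 0 < r := by linarith
  gcongr
  refine intervalIntegral.integral_mono_on hr (hu.intervalIntegrable_weight hd le_rfl hr)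
    (hw.intervalIntegrable_weight hd le_rfl hr) fun s hs => ?_
  have hs0 : 0 ≤ s := by linarith [hs.1]
  exact mul_le_mul_of_nonneg_left (hu.greenInner_mono hd hw huw hs.1) (by positivity)

theorem pow_mul_greenOp (B : ℝ) (u : ℝ → ℝ) {r : ℝ} (hr : 1 ≤ r) :
    r ^ d * greenOp d B u r = B + ∫ s in (1 : ℝ)..r, s ^ (d + 1) * greenInner d u s := by
  have hr0 : r ≠ 0 := by positivity
  unfold greenOp
  field_simp

/-- The function `r⁻²` is a supersolution: the bound on the inner integral gives an image of at most
`(B + (r^(d-2) - 1) / 2) / r^d`, which is at most `r⁻²` since `B ≤ 1`. -/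
theorem isAdmissible_greenOp (hd : 4 ≤ d) {B : ℝ} (hB0 : 0 ≤ B) (hB1 : B ≤ 1) (hu : IsAdmissible d u) :
    IsAdmissible d (greenOp d B u) := by
  have hwt : ∀ s : ℝ, 1 ≤ s → 0 ≤ s ^ (d + 1) * greenInner d u s := fun s hs =>
    mul_nonneg (pow_nonneg (by linarith) _) (hu.greenInner_nonneg hd hs)
  refine ⟨?_, fun r hr => ?_, fun r hr => ?_⟩
  · intro r hr s hs hrs
    have hr1 : 1 ≤ r := hr
    simp only [pow_mul_greenOp B u hr, pow_mul_greenOp B u hs]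
    have := intervalIntegral.integral_add_adjacent_intervals
      (hu.intervalIntegrable_weight hd le_rfl hr1) (hu.intervalIntegrable_weight hd hr1 hrs)
    have h2 := intervalIntegral.integral_nonneg (μ := volume) hrs
      fun x hx => hwt x (hr1.trans hx.1)
    linarith
  · have h2 := intervalIntegral.integral_nonneg (μ := volume) hr fun x hx => hwt x hx.1
    unfold greenOp
    positivity
  · have hr0 : 0 < r := by linarith
    obtain ⟨k, rfl⟩ : ∃ k, d = k + 4 := ⟨d - 4, by omega⟩
    have hI : ∫ s in (1 : ℝ)..r, s ^ (k + 4 + 1) * greenInner (k + 4) u s ≤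
        ∫ s in (1 : ℝ)..r, ((k : ℝ) + 2) / 2 * s ^ (k + 1) := by
      refine intervalIntegral.integral_mono_on hr (hu.intervalIntegrable_weight hd le_rfl hr)
        (Continuous.intervalIntegrable (by fun_prop) _ _) fun s hs => ?_
      have hs0 : 0 < s := by linarith [hs.1]
      have := hu.greenInner_le hd hs.1
      calc s ^ (k + 4 + 1) * greenInner (k + 4) u s
          ≤ s ^ (k + 4 + 1) * ((((k + 4 : ℕ) : ℝ) - 2) / 2 / s ^ 4) := by gcongr
        _ = ((k : ℝ) + 2) / 2 * s ^ (k + 1) := by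
          push_cast
          field_simp
          ring
    rw [intervalIntegral.integral_const_mul, integral_pow] at hI
    have e : ((k : ℝ) + 2) / 2 * ((r ^ (k + 1 + 1) - 1 ^ (k + 1 + 1)) / ((k + 1 : ℕ) + 1)) =
        (r ^ (k + 2) - 1) / 2 := by
      push_cast
      have : (k : ℝ) + 2 ≠ 0 := by positivity
      rw [one_pow, show (k : ℝ) + 1 + 1 = k + 2 by ring]
      field_simp
    rw [e] at hI
    have h1 : 1 ≤ r ^ (k + 2) := one_le_pow₀ hr
    unfold greenOp
    rw [div_le_div_iff₀ (by positivity) (by positivity), one_mul]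
    have e2 : r ^ (k + 4) = r ^ (k + 2) * r ^ 2 := by ring
    rw [e2]
    gcongr
    linarith

/-- Between an admissible function lying below its image and `r⁻²` there is a fixed point. -/
theorem exists_fixedPoint (hd : 4 ≤ d) {B : ℝ} (hB0 : 0 ≤ B) (hB1 : B ≤ 1) {φ : ℝ → ℝ}
    (hφ : IsAdmissible d φ) (hle : ∀ r, 1 ≤ r → φ r ≤ greenOp d B φ r) :
    ∃ u, IsAdmissible d u ∧ (∀ r, 1 ≤ r → φ r ≤ u r) ∧
      ∀ r, 1 ≤ r → u r = greenOp d B u r := by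
  -- Knaster–Tarski: the supremum of the functions lying below their image also lies below its
  -- image, and that image belongs to the same family.
  let P := {u : ℝ → ℝ // IsAdmissible d u ∧ ∀ r, 1 ≤ r → u r ≤ greenOp d B u r}
  have : Nonempty P := ⟨⟨φ, hφ, hle⟩⟩
  let U : ℝ → ℝ := fun r => ⨆ u : P, u.1 r
  have hbdd : ∀ r, 1 ≤ r → BddAbove (range fun u : P => u.1 r) := fun r hr => by
    refine ⟨1 / r ^ 2, ?_⟩
    rintro _ ⟨u, rfl⟩
    exact u.2.1.le r hr
  have hleU : ∀ (u : P) r, 1 ≤ r → u.1 r ≤ U r := fun u r hr => le_ciSup (hbdd r hr) u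
  have hU : IsAdmissible d U := by
    refine ⟨fun r hr s hs hrs => ?_, fun r hr => ?_, fun r hr => ciSup_le fun u => u.2.1.le r hr⟩
    · have hr1 : 1 ≤ r := hr
      have hr0 : 0 < r := by linarith
      have hs0 : 0 < s := by linarith
      change r ^ d * U r ≤ s ^ d * U s
      rw [mul_comm, ← le_div_iff₀ (by positivity)]
      refine ciSup_le fun u => ?_
      rw [le_div_iff₀ (by positivity), mul_comm]
      refine (u.2.1.monotoneOn hr hs hrs).trans ?_
      have := hleU u s hs
      simp only
      gcongr
    · exact (hφ.nonneg r hr).trans (hleU ⟨φ, hφ, hle⟩ r hr)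
  have hUle : ∀ r, 1 ≤ r → U r ≤ greenOp d B U r := fun r hr =>
    ciSup_le fun u => (u.2.2 r hr).trans (u.2.1.greenOp_mono hd B hU (hleU u) hr)
  have hG := hU.isAdmissible_greenOp hd hB0 hB1
  have hGle : ∀ r, 1 ≤ r → greenOp d B U r ≤ U r :=
    hleU ⟨_, hG, fun r hr => hU.greenOp_mono hd B hG hUle hr⟩
  exact ⟨U, hU, hleU ⟨φ, hφ, hle⟩, fun r hr => le_antisymm (hUle r hr) (hGle r hr)⟩

theorem hasDerivAt_greenInner (hd : 4 ≤ d) (hu : IsAdmissible d u)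
    (hc : ContinuousOn u (Ioi 1)) {r : ℝ} (hr : 1 < r) :
    HasDerivAt (greenInner d u) (-greenSource d u r) r := by
  have hcs : ContinuousOn (greenSource d u) (Ioi 1) := by
    have : ∀ r ∈ Ioi (1 : ℝ), r ≠ 0 := fun r hr => by
      have : (1 : ℝ) < r := hr
      positivity
    have h3 : ∀ r ∈ Ioi (1 : ℝ), r ^ 3 ≠ 0 := fun r hr => pow_ne_zero 3 (this r hr)
    unfold greenSource
    fun_prop (disch := assumption)
  have h1 := intervalIntegral.integral_hasDerivAt_right
    (hu.intervalIntegrable_greenSource hd hr.le)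
    (hcs.stronglyMeasurableAtFilter isOpen_Ioi r hr) (hcs.continuousAt (Ioi_mem_nhds hr))
  have h2 := h1.const_sub (greenInner d u 1)
  refine h2.congr_of_eventuallyEq ?_
  filter_upwards [Ioi_mem_nhds hr] with s hs using hu.greenInner_eq hd (le_of_lt hs)

theorem hasDerivAt_integral_weight (hd : 4 ≤ d) (hu : IsAdmissible d u) {r : ℝ} (hr : 1 < r) :
    HasDerivAt (fun r => ∫ s in (1 : ℝ)..r, s ^ (d + 1) * greenInner d u s)
      (r ^ (d + 1) * greenInner d u r) r := by
  have hcs : ContinuousOn (fun s : ℝ => s ^ (d + 1) * greenInner d u s) (Ioo 1 (r + 1)) :=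
    (by fun_prop : ContinuousOn (fun s : ℝ => s ^ (d + 1)) (Ioo 1 (r + 1))).mul
      ((hu.continuousOn_greenInner hd (r + 1)).mono Ioo_subset_Icc_self)
  have hmem : r ∈ Ioo 1 (r + 1) := ⟨hr, by linarith⟩
  exact intervalIntegral.integral_hasDerivAt_right (hu.intervalIntegrable_weight hd le_rfl hr.le)
    (hcs.stronglyMeasurableAtFilter isOpen_Ioo r hmem)
    (hcs.continuousAt (isOpen_Ioo.mem_nhds hmem))

/-- The fixed-point identity gives `r u' = r² G - d u`, with `G` the inner integral, hence this
flux. On differentiating it, the shift terms `2 d u / r` cancel and only `4 r u²` remains. -/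
theorem isFluxPair_of_fixedPoint (hd : 4 ≤ d) {B : ℝ} (hu : IsAdmissible d u)
    (hfix : ∀ r, 1 ≤ r → u r = greenOp d B u r) :
    IsFluxPair d u (fun r => r ^ 2 * greenInner d u r - 2 * u r) := by
  have hder : ∀ r, 1 < r → HasDerivAt u (r * greenInner d u r - d * u r / r) r := by
    intro r hr
    have hr0 : r ≠ 0 := by positivity
    have h1 := ((hu.hasDerivAt_integral_weight hd hr).const_add B).div (hasDerivAt_pow d r)
      (pow_ne_zero d hr0)
    have h2 : HasDerivAt u _ r := h1.congr_of_eventuallyEq (by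
      filter_upwards [Ioi_mem_nhds hr] with s hs using hfix s (le_of_lt hs))
    refine h2.congr_deriv ?_
    rw [← pow_mul_greenOp B u hr.le, ← hfix r hr.le]
    obtain ⟨k, rfl⟩ : ∃ k, d = k + 1 := ⟨d - 1, by omega⟩
    rw [add_tsub_cancel_right]
    field_simp
    ring
  -- Bootstrap: differentiability of `u` needs only continuity of the inner integral; the continuity
  -- of `u` gained here then makes the inner integral differentiable.
  have hc : ContinuousOn u (Ioi 1) := fun r hr => (hder r hr).continuousAt.continuousWithinAt
  refine ⟨fun r hr => hu.nonneg r hr.le, fun r hr => ?_, fun r hr => ?_⟩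
  · have hr0 : r ≠ 0 := by positivity
    refine (hder r hr).congr_deriv ?_
    field_simp
    ring
  · have hr0 : r ≠ 0 := by positivity
    refine (((hasDerivAt_pow 2 r).mul (hu.hasDerivAt_greenInner hd hc hr)).sub
      ((hder r hr).const_mul 2)).congr_deriv ?_
    unfold greenSource
    field_simp
    ring

end IsAdmissible

/-- A subsolution `φ`, given through the derivative `r ^ (d + 1) * ζ` of `r ^ d * φ`, lies below a solution. -/
theorem exists_isNonnegSolution_ge {d : ℕ} (hd : 4 ≤ d) {φ ζ ζ' : ℝ → ℝ}
    (h0 : ∀ r, 1 ≤ r → 0 ≤ φ r) (hle : ∀ r, 1 ≤ r → φ r ≤ 1 / r ^ 2)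
    (hφ : ∀ r, 1 ≤ r → HasDerivAt (fun r => r ^ d * φ r) (r ^ (d + 1) * ζ r) r)
    (hζ0 : ∀ r, 1 ≤ r → 0 ≤ ζ r) (hζ : ∀ r, 1 < r → HasDerivAt ζ (ζ' r) r)
    (hsub : ∀ r, 1 < r → -greenSource d φ r ≤ ζ' r) (hlim : Tendsto ζ atTop (𝓝 0)) :
    ∃ u, IsNonnegSolution d u ∧ ∀ r, 1 < r → φ r ≤ u r := by
  have hcont : ContinuousOn (fun r => r ^ d * φ r) (Ici 1) := fun r hr =>
    (hφ r hr).continuousAt.continuousWithinAt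
  have hadm : IsAdmissible d φ := by
    refine ⟨monotoneOn_of_deriv_nonneg (convex_Ici 1) hcont ?_ ?_, h0, hle⟩ <;> rw [interior_Ici]
    · exact fun r hr => (hφ r (le_of_lt hr)).differentiableAt.differentiableWithinAt
    · intro r hr
      have hr1 : 1 < r := hr
      rw [(hφ r hr1.le).deriv]
      have := hζ0 r hr1.le
      positivity
  have hφc : ContinuousOn φ (Ioi 1) := by
    have h1 : ContinuousOn (fun r : ℝ => r ^ d * φ r / r ^ d) (Ioi 1) :=
      (hcont.mono Ioi_subset_Ici_self).div (by fun_prop) fun r hr => by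
        have : (1 : ℝ) < r := hr
        positivity
    refine h1.congr fun r hr => ?_
    have : (1 : ℝ) < r := hr
    field_simp
  have hinner : Tendsto (greenInner d φ) atTop (𝓝 0) := by
    have h1 : Tendsto (fun s : ℝ => ((d : ℝ) - 2) / 2 / s ^ 4) atTop (𝓝 0) :=
      tendsto_const_nhds.div_atTop (tendsto_pow_atTop (by norm_num))
    refine tendsto_of_tendsto_of_tendsto_of_le_of_le' tendsto_const_nhds h1 ?_ ?_
    · filter_upwards [eventually_ge_atTop 1] with s hs using hadm.greenInner_nonneg hd hs
    · filter_upwards [eventually_ge_atTop 1] with s hs using hadm.greenInner_le hd hs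
  -- First integration, from infinity: the difference is nonincreasing by the subsolution inequality
  -- and tends to `0`.
  have hζle : ∀ r, 1 < r → 0 ≤ greenInner d φ r - ζ r := fun r hr =>
    nonneg_of_hasDerivAt_nonpos_of_tendsto (f := fun r => greenInner d φ r - ζ r)
      (fun x hx => (hadm.hasDerivAt_greenInner hd hφc hx).sub (hζ x hx))
      (fun x hx => by linarith [hsub x hx]) (by simpa using hinner.sub hlim) hr
  have hB0 := h0 1 le_rfl
  have hB1 : φ 1 ≤ 1 := by simpa using hle 1 le_rfl
  -- Second integration, from `1`, where the boundary value `B = φ 1` makes both sides agree.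
  have hgreen : ∀ r, 1 ≤ r → φ r ≤ greenOp d (φ 1) φ r := by
    intro r hr
    have hr0 : 0 < r := by linarith
    have hder : ∀ x ∈ Ioo 1 r, HasDerivAt
        (fun r => (∫ s in (1 : ℝ)..r, s ^ (d + 1) * greenInner d φ s) - r ^ d * φ r)
        (x ^ (d + 1) * greenInner d φ x - x ^ (d + 1) * ζ x) x := fun x hx =>
      (hadm.hasDerivAt_integral_weight hd hx.1).sub (hφ x hx.1.le)
    have hprim := intervalIntegral.continuousOn_primitive_interval'
      (hadm.intervalIntegrable_weight hd le_rfl hr) (a := 1) (by simp)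
    rw [uIcc_of_le hr] at hprim
    have hmono : MonotoneOn
        (fun r => (∫ s in (1 : ℝ)..r, s ^ (d + 1) * greenInner d φ s) - r ^ d * φ r)
        (Icc 1 r) := by
      refine monotoneOn_of_deriv_nonneg (convex_Icc 1 r)
        (hprim.sub (hcont.mono Icc_subset_Ici_self)) ?_ ?_ <;> rw [interior_Icc]
      · exact fun x hx => (hder x hx).differentiableAt.differentiableWithinAt
      · intro x hx
        rw [(hder x hx).deriv, ← mul_sub]
        have : 0 < x := by linarith [hx.1]
        exact mul_nonneg (by positivity) (hζle x hx.1)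
    have h1 := hmono ⟨le_rfl, hr⟩ ⟨hr, le_rfl⟩ hr
    simp only [intervalIntegral.integral_same, one_pow, one_mul] at h1
    unfold greenOp
    rw [le_div_iff₀ (by positivity)]
    linarith
  obtain ⟨u, hu, hφu, hfix⟩ := hadm.exists_fixedPoint hd hB0 hB1 hgreen
  exact ⟨u, (hu.isFluxPair_of_fixedPoint hd hfix).isNonnegSolution, fun r hr => hφu r hr.le⟩

/-- The subsolution is `r^(1-d) / 2`. Decaying one power faster than the fundamental solution makes
it strictly subharmonic, with Laplacian `(d-1)/2 · r^(-d-1)`, which dominates `4 φ² = r^(2-2d)`. -/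
theorem exists_isNonnegSolution_pos {d : ℕ} (hd : 4 ≤ d) :
    ∃ u, IsNonnegSolution d u ∧ ∀ r, 1 < r → 0 < u r := by
  obtain ⟨k, rfl⟩ : ∃ k, d = k + 4 := ⟨d - 4, by omega⟩
  suffices ∃ u, IsNonnegSolution (k + 4) u ∧ ∀ r, 1 < r → 1 / 2 / r ^ (k + 3) ≤ u r by
    obtain ⟨u, hu, hle⟩ := this
    exact ⟨u, hu, fun r hr => lt_of_lt_of_le (by positivity) (hle r hr)⟩
  refine exists_isNonnegSolution_ge hd
    (φ := fun r => 1 / 2 / r ^ (k + 3)) (ζ := fun r => 1 / 2 / r ^ (k + 5))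
    (ζ' := fun r => -((k : ℝ) + 5) / 2 / r ^ (k + 6)) (fun r hr => by positivity) ?_ ?_
    (fun r hr => by positivity) ?_ ?_
    (tendsto_const_nhds.div_atTop (tendsto_pow_atTop (by omega)))
  · intro r hr
    have : r ^ 2 ≤ r ^ (k + 3) := pow_le_pow_right₀ hr (by omega)
    have hr0 : 0 < r := by linarith
    rw [div_le_div_iff₀ (by positivity) (by positivity)]
    nlinarith [pow_pos hr0 2]
  · intro r hr
    have hr0 : 0 < r := by linarith
    have h1 : HasDerivAt (fun r : ℝ => r / 2) (1 / 2) r := (hasDerivAt_id r).div_const 2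
    refine (h1.congr_of_eventuallyEq ?_).congr_deriv ?_
    · filter_upwards [Ioi_mem_nhds hr0] with s hs
      have : s ≠ 0 := ne_of_gt hs
      field_simp
      ring
    · field_simp
  · intro r hr
    have hr0 : r ≠ 0 := by positivity
    refine (((hasDerivAt_pow (k + 5) r).inv (pow_ne_zero _ hr0)).const_mul (1 / 2)).congr_deriv ?_
    rw [show k + 5 - 1 = k + 4 by omega]
    push_cast
    field_simp
    ring
  · intro r hr
    have hr0 : 0 < r := by linarith
    have hk : (1 : ℝ) ≤ r ^ (k + 1) := one_le_pow₀ hr.le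
    unfold greenSource
    have e : -(2 * ((k + 4 : ℕ) : ℝ) * (1 / 2 / r ^ (k + 3)) / r ^ 3 -
        4 * (1 / 2 / r ^ (k + 3)) ^ 2 / r) =
        (1 / r ^ (k + 1) - ((k : ℝ) + 4)) / r ^ (k + 6) := by
      push_cast
      field_simp
      ring
    rw [e]
    gcongr
    have : 1 / r ^ (k + 1) ≤ 1 := by rw [div_le_one (by positivity)]; exact hk
    have hk0 : (0 : ℝ) ≤ k := Nat.cast_nonneg k
    linarith

theorem IsMaximalNonnegSolution.pos {d : ℕ} (hd : 4 ≤ d) {u : ℝ → ℝ}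
    (hu : IsMaximalNonnegSolution d u) {r : ℝ} (hr : 1 < r) : 0 < u r := by
  obtain ⟨v, hv, hpos⟩ := exists_isNonnegSolution_pos hd
  exact (hpos r hr).trans_le (hu.le_of_isNonnegSolution v hv r hr)

/-! ### Asymptotics in dimension at least five -/

theorem exists_tendsto_of_antitoneOn {m : ℝ → ℝ} (hm : AntitoneOn m (Ioi 1))
    (h0 : ∀ r, 1 < r → 0 ≤ m r) :
    ∃ a, 0 ≤ a ∧ Tendsto m atTop (𝓝 a) ∧ ∀ r, 1 < r → a ≤ m r := by
  have hanti : Antitone fun r => m (max r 2) := fun x y hxy =>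
    hm (by simp only [mem_Ioi, lt_max_iff]; right; norm_num)
      (by simp only [mem_Ioi, lt_max_iff]; right; norm_num) (max_le_max_right 2 hxy)
  have hbd : BddBelow (range fun r => m (max r 2)) := by
    refine ⟨0, ?_⟩
    rintro _ ⟨r, rfl⟩
    exact h0 _ (by simp only [lt_max_iff]; right; norm_num)
  have hlim := tendsto_atTop_ciInf hanti hbd
  have hlim' : Tendsto m atTop (𝓝 (⨅ r, m (max r 2))) := by
    refine hlim.congr' ?_
    filter_upwards [eventually_ge_atTop 2] with r hr
    rw [max_eq_left hr]
  have hle : ∀ r, 1 < r → (⨅ r, m (max r 2)) ≤ m r := by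
    intro r hr
    refine le_of_tendsto hlim' ?_
    filter_upwards [eventually_ge_atTop r] with x hx
    exact hm hr (hr.trans_le hx) hx
  refine ⟨_, ?_, hlim', hle⟩
  refine ge_of_tendsto hlim' ?_
  filter_upwards [eventually_gt_atTop 1] with x hx using h0 x hx

theorem tendsto_div_pow_atTop_zero (c : ℝ) {n : ℕ} (hn : n ≠ 0) :
    Tendsto (fun r : ℝ => c / r ^ n) atTop (𝓝 0) :=
  tendsto_const_nhds.div_atTop (tendsto_pow_atTop hn)

theorem hasDerivAt_div_pow (c : ℝ) (n : ℕ) {r : ℝ} (hr : r ≠ 0) :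
    HasDerivAt (fun r : ℝ => c / r ^ (n + 1)) (-(c * (n + 1)) / r ^ (n + 2)) r := by
  refine (((hasDerivAt_pow (n + 1) r).inv (pow_ne_zero _ hr)).const_mul c).congr_deriv ?_
  rw [add_tsub_cancel_right]
  push_cast
  field_simp
  ring

/-- Second-order upper bound in dimension `k + 5`. -/
theorem IsFluxPair.pow_mul_le_add {k : ℕ} {u h : ℝ → ℝ} (H : IsFluxPair (k + 5) u h) {a : ℝ}
    (ha : Tendsto (fun r => r ^ (k + 3) * u r) atTop (𝓝 a)) {r₀ r : ℝ} (hr₀ : 1 < r₀)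
    (hr : r₀ < r) : r ^ (k + 3) * u r ≤ a + (r₀ ^ (k + 3) * u r₀) ^ 2 / r ^ (k + 1) := by
  have S : IsSubharmonicPair (k + 3 + 2) u h _ := H.isSubharmonicPair (by omega)
  have hanti := S.antitoneOn_pow_mul
  set M := r₀ ^ (k + 3) * u r₀ with hM
  have hmM : ∀ x, r₀ < x → x ^ (k + 3) * u x ≤ M := fun x hx =>
    hanti hr₀ (hr₀.trans hx) hx.le
  have hk : (0 : ℝ) ≤ k := Nat.cast_nonneg k
  -- Integrating `h' = 4 m² r^(-2k-5) ≤ 4 M² r^(-2k-5)` from infinity, where `m = r^(k+3) u`,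
  -- produces this constant; a second integration of `m' = r^(k+2) h` gives the next one.
  have hflux : ∀ x, r₀ < x → -h x - (2 * M ^ 2 / (k + 2)) / x ^ (2 * k + 3 + 1) ≤ 0 := by
    intro x hx
    refine nonpos_of_hasDerivAt_nonneg_of_tendsto
      (f := fun x => -h x - (2 * M ^ 2 / (k + 2)) / x ^ (2 * k + 3 + 1))
      (f' := fun x => -(4 * x * u x ^ 2) -
        -((2 * M ^ 2 / (k + 2)) * ((2 * k + 3 : ℕ) + 1)) / x ^ (2 * k + 3 + 2)) (a := r₀)
      (fun y hy => ?_) (fun y hy => ?_) ?_ hx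
    · have hy0 : y ≠ 0 := by have : 1 < y := hr₀.trans hy; positivity
      exact (H.hasDerivAt_flux y (hr₀.trans hy)).neg.sub (hasDerivAt_div_pow _ _ hy0)
    · have hy1 : 1 < y := hr₀.trans hy
      have hy0 : 0 < y := by linarith
      have h1 : (y ^ (k + 3) * u y) ^ 2 ≤ M ^ 2 :=
        pow_le_pow_left₀ (mul_nonneg (by positivity) (H.nonneg y hy1)) (hmM y hy) 2
      have e : -(4 * y * u y ^ 2) -
          -((2 * M ^ 2 / (k + 2)) * ((2 * k + 3 : ℕ) + 1)) / y ^ (2 * k + 3 + 2) =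
          4 * (M ^ 2 - (y ^ (k + 3) * u y) ^ 2) / y ^ (2 * k + 3 + 2) := by
        push_cast
        field_simp
        ring
      rw [e]
      have := sub_nonneg.2 h1
      positivity
    · simpa using ((S.flux_tendsto_zero (by omega)).neg).sub
        (tendsto_div_pow_atTop_zero (2 * M ^ 2 / (k + 2)) (show 2 * k + 3 + 1 ≠ 0 by omega))
  have hE : r ^ (k + 3) * u r - a - (2 * M ^ 2 / ((k + 2) * (k + 1))) / r ^ (k + 1) ≤ 0 := by
    refine nonpos_of_hasDerivAt_nonneg_of_tendsto
      (f := fun r => r ^ (k + 3) * u r - a - (2 * M ^ 2 / ((k + 2) * (k + 1))) / r ^ (k + 1))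
      (f' := fun r => r ^ (k + 3) * h r / r -
        -((2 * M ^ 2 / ((k + 2) * (k + 1))) * (k + 1)) / r ^ (k + 2)) (a := r₀)
      (fun y hy => ?_) (fun y hy => ?_) ?_ hr
    · have hy0 : y ≠ 0 := by have : 1 < y := hr₀.trans hy; positivity
      exact ((S.hasDerivAt_pow_mul (hr₀.trans hy)).sub_const a).sub (hasDerivAt_div_pow _ _ hy0)
    · have hy1 : 1 < y := hr₀.trans hy
      have hy0 : 0 < y := by linarith
      have e : y ^ (k + 3) * h y / y -
          -((2 * M ^ 2 / ((k + 2) * (k + 1))) * (k + 1)) / y ^ (k + 2) =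
          y ^ (k + 2) * -(-h y - (2 * M ^ 2 / (k + 2)) / y ^ (2 * k + 3 + 1)) := by
        field_simp
        ring
      rw [e]
      exact mul_nonneg (by positivity) (neg_nonneg.2 (hflux y hy))
    · simpa using (ha.sub_const a).sub
        (tendsto_div_pow_atTop_zero (2 * M ^ 2 / ((k + 2) * (k + 1))) (show k + 1 ≠ 0 by omega))
  have hr0 : 0 < r := by linarith
  have hC : (2 * M ^ 2 / (((k : ℝ) + 2) * (k + 1))) / r ^ (k + 1) ≤ M ^ 2 / r ^ (k + 1) := by
    gcongr
    rw [div_le_iff₀ (by positivity)]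
    nlinarith [sq_nonneg M, mul_nonneg hk hk, mul_nonneg (sq_nonneg M) hk,
      mul_nonneg (sq_nonneg M) (mul_nonneg hk hk)]
  linarith

/-- Positive solutions in dimension `k + 5` decay exactly like the fundamental solution. -/
theorem IsFluxPair.limit_pos {k : ℕ} {u h : ℝ → ℝ} (H : IsFluxPair (k + 5) u h)
    (hpos : ∀ r, 1 < r → 0 < u r) {a : ℝ} (ha0 : 0 ≤ a)
    (ha : Tendsto (fun r => r ^ (k + 3) * u r) atTop (𝓝 a)) : 0 < a := by
  rcases ha0.eq_or_lt with rfl | h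
  swap
  · exact h
  exfalso
  -- With `a = 0`, letting the outer point decrease to `r` in the upper bound gives `m ≤ m² /
  -- r^(k+1)`. Dividing by `m > 0` keeps `m` above `1`, against `m → 0`.
  have key : ∀ r, 1 < r → r ^ (k + 1) ≤ r ^ (k + 3) * u r := by
    intro r hr
    have hr0 : 0 < r := by linarith
    have hc : ContinuousAt (fun r => r ^ (k + 3) * u r) r :=
      (continuousAt_id.pow _).mul (H.hasDerivAt r hr).continuousAt
    have hc2 : ContinuousAt (fun x => (r ^ (k + 3) * u r) ^ 2 / x ^ (k + 1)) r :=
      continuousAt_const.div (continuousAt_id.pow _) (by simp; positivity)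
    have h1 : r ^ (k + 3) * u r ≤ (r ^ (k + 3) * u r) ^ 2 / r ^ (k + 1) := by
      refine le_of_tendsto_of_tendsto (b := 𝓝[>] r) (hc.mono_left nhdsWithin_le_nhds)
        (hc2.mono_left nhdsWithin_le_nhds) ?_
      filter_upwards [self_mem_nhdsWithin] with x hx
      simpa using H.pow_mul_le_add ha hr hx
    have hm : 0 < r ^ (k + 3) * u r := mul_pos (by positivity) (hpos r hr)
    rw [le_div_iff₀ (by positivity), sq] at h1
    exact le_of_mul_le_mul_left h1 hm
  obtain ⟨r, hr⟩ := ((ha.eventually_lt_const one_pos).and (eventually_gt_atTop 1)).exists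
  linarith [key r hr.2, hr.1, one_le_pow₀ (n := k + 1) hr.2.le]

theorem IsMaximalNonnegSolution.asymptotics_of_five_le {d : ℕ} (hd : 5 ≤ d) :
    ∃ a₀ b₀ b₁ : ℝ, 0 < a₀ ∧ 0 < b₀ ∧ 0 < b₁ ∧
      ∀ u : ℝ → ℝ, IsMaximalNonnegSolution d u →
        Tendsto (fun r : ℝ => r ^ ((d : ℤ) - 2) * u r) atTop (𝓝 a₀) ∧
        (∀ r : ℝ, 1 < r → a₀ * r ^ (2 - (d : ℤ)) ≤ u r) ∧
        (∀ r : ℝ, 4 / 3 ≤ r → u r ≤ b₀ * r ^ (2 - (d : ℤ))) ∧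
        (∀ r : ℝ, 4 / 3 ≤ r →
          u r ≤ a₀ * r ^ (2 - (d : ℤ)) + b₁ * r ^ (6 - 2 * (d : ℤ))) := by
  obtain ⟨k, rfl⟩ : ∃ k, d = k + 5 := ⟨d - 5, by omega⟩
  obtain ⟨w, hw⟩ := exists_isMaximalNonnegSolution (d := k + 5) (by omega)
  have H := hw.isNonnegSolution.isFluxPair
  have S : IsSubharmonicPair (k + 3 + 2) w _ _ := H.isSubharmonicPair (by omega)
  have hpos : ∀ r, 1 < r → 0 < w r := fun r hr => hw.pos (by omega) hr
  obtain ⟨a, ha0, ha, hle⟩ := exists_tendsto_of_antitoneOn S.antitoneOn_pow_mul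
    fun r hr => mul_nonneg (pow_nonneg (by linarith) _) (S.nonneg r hr)
  have ha' := H.limit_pos hpos ha0 ha
  have h43 : (1 : ℝ) < 4 / 3 := by norm_num
  have h76 : (1 : ℝ) < 7 / 6 := by norm_num
  -- The second-order bound needs a base point strictly inside `r ≥ 4/3`, hence `7/6`. All constants
  -- come from one maximal solution and transfer by uniqueness.
  refine ⟨a, (4 / 3) ^ (k + 3) * w (4 / 3), ((7 / 6) ^ (k + 3) * w (7 / 6)) ^ 2, ha',
    mul_pos (by positivity) (hpos _ h43),
    pow_pos (mul_pos (by positivity) (hpos _ h76)) 2, fun u hu => ?_⟩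
  have huw : ∀ r, 1 < r → u r = w r := fun r hr => hu.eq hw hr
  have e1 : (((k + 5 : ℕ) : ℤ) - 2) = ((k + 3 : ℕ) : ℤ) := by push_cast; ring
  have e2 : (2 - ((k + 5 : ℕ) : ℤ)) = -((k + 3 : ℕ) : ℤ) := by push_cast; ring
  have e3 : (6 - 2 * ((k + 5 : ℕ) : ℤ)) = -((2 * k + 4 : ℕ) : ℤ) := by push_cast; ring
  simp only [e1, e2, e3, zpow_neg, zpow_natCast]
  refine ⟨?_, fun r hr => ?_, fun r hr => ?_, fun r hr => ?_⟩
  · refine ha.congr' ?_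
    filter_upwards [eventually_gt_atTop 1] with r hr
    rw [huw r hr]
  · have hr0 : 0 < r := by linarith
    rw [huw r hr, ← div_eq_mul_inv, div_le_iff₀ (by positivity), mul_comm]
    exact hle r hr
  · have hr1 : 1 < r := by linarith
    have hr0 : 0 < r := by linarith
    rw [huw r hr1, ← div_eq_mul_inv, le_div_iff₀ (by positivity), mul_comm]
    exact S.antitoneOn_pow_mul h43 hr1 hr
  · have hr1 : 1 < r := by linarith
    have hr0 : 0 < r := by linarith
    have h1 := H.pow_mul_le_add ha h76 (show 7 / 6 < r by linarith)
    rw [huw r hr1]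
    have h2 : w r = r ^ (k + 3) * w r * (r ^ (k + 3))⁻¹ := by field_simp
    rw [h2]
    refine (mul_le_mul_of_nonneg_right h1 (by positivity)).trans_eq ?_
    field_simp
    ring

/-! ### Lower bound in dimension four -/

theorem half_lt_log_two_mul {r : ℝ} (hr : 1 ≤ r) : 1 / 2 < Real.log (2 * r) := by
  have h1 : Real.log 2 ≤ Real.log (2 * r) := Real.log_le_log (by norm_num) (by linarith)
  linarith [Real.log_two_gt_d9]

theorem hasDerivAt_log_two_mul {r : ℝ} (hr : 1 ≤ r) :
    HasDerivAt (fun r => Real.log (2 * r)) (1 / r) r := by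
  have hr0 : r ≠ 0 := by positivity
  refine (((hasDerivAt_id r).const_mul 2).log (by simp [hr0])).congr_deriv ?_
  simp only [id]
  field_simp

/-- With `L = log (2 r)`, the subsolution inequality holds with surplus `1 / (L³ r⁵)`. The factor 2
inside the logarithm ensures `L ≥ 1/2` up to `r = 1`, as needed both for `φ ≤ r⁻²` and for `ζ ≥ 0`.
-/
theorem exists_isNonnegSolution_four_ge :
    ∃ u, IsNonnegSolution 4 u ∧
      ∀ r : ℝ, 1 < r → 1 / 2 * (r ^ 2)⁻¹ * (Real.log (2 * r))⁻¹ ≤ u r := by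
  have hpos : ∀ r : ℝ, 1 ≤ r → 0 < Real.log (2 * r) := fun r hr => by
    linarith [half_lt_log_two_mul hr]
  have hinv : ∀ r : ℝ, 1 ≤ r → (Real.log (2 * r))⁻¹ ≤ 2 := fun r hr => by
    rw [inv_le_comm₀ (hpos r hr) two_pos]
    linarith [half_lt_log_two_mul hr]
  have hζ0 : ∀ r : ℝ, 1 ≤ r →
      0 ≤ (1 / Real.log (2 * r) - 1 / (2 * Real.log (2 * r) ^ 2)) / r ^ 4 := fun r hr => by
    have h1 := hpos r hr
    have e : 1 / Real.log (2 * r) - 1 / (2 * Real.log (2 * r) ^ 2) =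
        (2 * Real.log (2 * r) - 1) / (2 * Real.log (2 * r) ^ 2) := by field_simp
    rw [e]
    have : 0 ≤ 2 * Real.log (2 * r) - 1 := by linarith [half_lt_log_two_mul hr]
    positivity
  refine exists_isNonnegSolution_ge (le_refl 4)
    (φ := fun r => 1 / 2 * (r ^ 2)⁻¹ * (Real.log (2 * r))⁻¹)
    (ζ := fun r => (1 / Real.log (2 * r) - 1 / (2 * Real.log (2 * r) ^ 2)) / r ^ 4)
    (ζ' := fun r => (-4 / Real.log (2 * r) + 1 / Real.log (2 * r) ^ 2 +
      1 / Real.log (2 * r) ^ 3) / r ^ 5) (fun r hr => ?_) (fun r hr => ?_) (fun r hr => ?_)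
    hζ0 (fun r hr => ?_) (fun r hr => ?_) ?_
  · have := hpos r hr
    positivity
  · have := hinv r hr
    have h2 : 0 ≤ (r ^ 2)⁻¹ := by positivity
    rw [one_div (r ^ 2)]
    nlinarith [mul_le_mul_of_nonneg_left this h2]
  · have hr0 : 0 < r := by linarith
    have hl := hpos r hr
    have h1 := (hasDerivAt_pow 2 r).div ((hasDerivAt_log_two_mul hr).const_mul 2)
      (by positivity : 2 * Real.log (2 * r) ≠ 0)
    refine (h1.congr_of_eventuallyEq ?_).congr_deriv ?_
    · filter_upwards [Ioi_mem_nhds hr0] with s hs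
      have : s ≠ 0 := ne_of_gt hs
      simp only [Pi.div_apply]
      field_simp
    · field_simp
      ring
  · have hr0 : 0 < r := by linarith
    have hl := hpos r hr.le
    have hL := hasDerivAt_log_two_mul hr.le
    have h1 := ((hL.inv hl.ne').sub (((hL.pow 2).const_mul 2).inv
      (by simp only [Pi.pow_apply]; positivity))).div
      (hasDerivAt_pow 4 r) (by positivity)
    refine (h1.congr_of_eventuallyEq ?_).congr_deriv ?_
    · filter_upwards with s
      simp [one_div]
    · simp only [Pi.sub_apply, Pi.inv_apply, Pi.pow_apply]
      generalize Real.log (2 * r) = l at hl ⊢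
      field_simp
      ring
  · have hr0 : 0 < r := by linarith
    have hl := hpos r hr.le
    unfold greenSource
    have e : -(2 * ((4 : ℕ) : ℝ) * (1 / 2 * (r ^ 2)⁻¹ * (Real.log (2 * r))⁻¹) / r ^ 3 -
        4 * (1 / 2 * (r ^ 2)⁻¹ * (Real.log (2 * r))⁻¹) ^ 2 / r) =
        (-4 / Real.log (2 * r) + 1 / Real.log (2 * r) ^ 2) / r ^ 5 := by
      push_cast
      field_simp
      ring
    rw [e]
    have : 0 < 1 / Real.log (2 * r) ^ 3 := by positivity
    exact div_le_div_of_nonneg_right (by linarith) (by positivity)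
  · refine tendsto_of_tendsto_of_tendsto_of_le_of_le' tendsto_const_nhds
      (tendsto_div_pow_atTop_zero 2 four_ne_zero) ?_ ?_
    · filter_upwards [eventually_ge_atTop 1] with r hr using hζ0 r hr
    · filter_upwards [eventually_ge_atTop 1] with r hr
      have h1 := hinv r hr
      have h2 : 0 ≤ 1 / (2 * Real.log (2 * r) ^ 2) := by positivity
      gcongr
      rw [one_div (Real.log (2 * r))]
      linarith

theorem IsMaximalNonnegSolution.four_ge {u : ℝ → ℝ} (hu : IsMaximalNonnegSolution 4 u) {r : ℝ}
    (hr : 1 < r) : 1 / 2 * (r ^ 2)⁻¹ * (Real.log (2 * r))⁻¹ ≤ u r := by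
  obtain ⟨v, hv, hle⟩ := exists_isNonnegSolution_four_ge
  exact (hle r hr).trans (hu.le_of_isNonnegSolution v hv r hr)

/-! ### Upper bounds in dimension four -/

namespace IsFluxPair

variable {u h : ℝ → ℝ}

theorem four_hasDerivAt_sq_mul (H : IsFluxPair 4 u h) {r : ℝ} (hr : 1 < r) :
    HasDerivAt (fun r => r ^ 2 * u r) (r * h r) r := by
  have S : IsSubharmonicPair (2 + 2) u h _ := H.isSubharmonicPair (by norm_num)
  have hr0 : r ≠ 0 := by positivity
  refine (S.hasDerivAt_pow_mul hr).congr_deriv ?_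
  field_simp

theorem four_sq_mul_nonneg (H : IsFluxPair 4 u h) {r : ℝ} (hr : 1 < r) : 0 ≤ r ^ 2 * u r :=
  mul_nonneg (sq_nonneg r) (H.nonneg r hr)

theorem four_antitoneOn_sq_mul (H : IsFluxPair 4 u h) :
    AntitoneOn (fun r => r ^ 2 * u r) (Ioi 1) := by
  have S : IsSubharmonicPair (2 + 2) u h _ := H.isSubharmonicPair (by norm_num)
  exact S.antitoneOn_pow_mul

theorem four_flux_nonpos (H : IsFluxPair 4 u h) {r : ℝ} (hr : 1 < r) : h r ≤ 0 :=
  (H.isSubharmonicPair (by norm_num)).flux_nonpos hr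

theorem four_flux_tendsto_zero (H : IsFluxPair 4 u h) : Tendsto h atTop (𝓝 0) :=
  (H.isSubharmonicPair (by norm_num)).flux_tendsto_zero (by norm_num)

theorem four_exists_tendsto (H : IsFluxPair 4 u h) :
    ∃ a, 0 ≤ a ∧ Tendsto (fun r => r ^ 2 * u r) atTop (𝓝 a) ∧ ∀ r, 1 < r → a ≤ r ^ 2 * u r :=
  exists_tendsto_of_antitoneOn H.four_antitoneOn_sq_mul fun _ hr => H.four_sq_mul_nonneg hr

/-- A limit `a > 0` would give `-h ≥ 2 a² / r²`, hence `(r² u)' ≤ -2 a² / r` and divergence to `-∞`.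
-/
theorem four_tendsto_sq_mul (H : IsFluxPair 4 u h) :
    Tendsto (fun r => r ^ 2 * u r) atTop (𝓝 0) := by
  obtain ⟨a, ha0, ha, hle⟩ := H.four_exists_tendsto
  rcases ha0.eq_or_lt with rfl | hpos
  · exact ha
  exfalso
  have hflux : ∀ r, 1 < r → 0 ≤ -h r - 2 * a ^ 2 / r ^ (1 + 1) := by
    intro r hr
    refine nonneg_of_hasDerivAt_nonpos_of_tendsto
      (f := fun r => -h r - 2 * a ^ 2 / r ^ (1 + 1))
      (f' := fun r => -(4 * r * u r ^ 2) - -(2 * a ^ 2 * ((1 : ℕ) + 1)) / r ^ (1 + 2)) (a := 1)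
      (fun y hy => ?_) (fun y hy => ?_) ?_ hr
    · have hy0 : y ≠ 0 := by positivity
      exact (H.hasDerivAt_flux y hy).neg.sub (hasDerivAt_div_pow _ _ hy0)
    · have hy0 : 0 < y := by linarith
      have h1 : a ^ 2 ≤ (y ^ 2 * u y) ^ 2 := pow_le_pow_left₀ ha0 (hle y hy) 2
      have e : -(4 * y * u y ^ 2) - -(2 * a ^ 2 * ((1 : ℕ) + 1)) / y ^ (1 + 2) =
          4 * (a ^ 2 - (y ^ 2 * u y) ^ 2) / y ^ 3 := by
        push_cast
        field_simp
        ring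
      rw [e]
      exact div_nonpos_of_nonpos_of_nonneg (by linarith) (by positivity)
    · simpa using H.four_flux_tendsto_zero.neg.sub
        (tendsto_div_pow_atTop_zero (2 * a ^ 2) (show 1 + 1 ≠ 0 by norm_num))
  have hneg : Tendsto (fun r => -(r ^ 2 * u r)) atTop (𝓝 (-a)) := ha.neg
  refine not_tendsto_nhds_of_tendsto_atTop (tendsto_atTop_of_div_le_hasDerivAt
    (c := 2 * a ^ 2) (by positivity) (f := fun r => -(r ^ 2 * u r))
    (f' := fun r => -(r * h r)) ?_ ?_) _ hneg
  · filter_upwards [eventually_gt_atTop 1] with x hx using (H.four_hasDerivAt_sq_mul hx).neg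
  · filter_upwards [eventually_gt_atTop 1] with x hx
    have hx0 : 0 < x := by linarith
    have h1 := mul_nonneg hx0.le (hflux x hx)
    have e : x * (-h x - 2 * a ^ 2 / x ^ (1 + 1)) = -(x * h x) - 2 * a ^ 2 / x := by
      field_simp
      ring
    rw [e] at h1
    linarith

theorem four_tendsto_pow_div (H : IsFluxPair 4 u h) (c : ℝ) {n : ℕ} :
    Tendsto (fun r => c * (r ^ 2 * u r) ^ n / r ^ 2) atTop (𝓝 0) :=
  ((H.four_tendsto_sq_mul.pow n).const_mul c).div_atTop (tendsto_pow_atTop two_ne_zero)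

/-- Here `2 m² / r²`, with `m = r² u`, is what `∫ 4 m² / x³` from `r` to infinity would be for
constant `m`; since `m` decreases, it overestimates `-h`. -/
theorem four_neg_flux_le (H : IsFluxPair 4 u h) {r : ℝ} (hr : 1 < r) :
    -h r - 2 * (r ^ 2 * u r) ^ 2 / r ^ 2 ≤ 0 := by
  refine nonpos_of_hasDerivAt_nonneg_of_tendsto
    (f := fun r => -h r - 2 * (r ^ 2 * u r) ^ 2 / r ^ 2)
    (f' := fun r => 4 * (r ^ 2 * u r) * -h r / r) (a := 1) (fun y hy => ?_) (fun y hy => ?_) ?_ hr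
  · have hy0 : y ≠ 0 := by positivity
    refine ((H.hasDerivAt_flux y hy).neg.sub ((((H.four_hasDerivAt_sq_mul hy).pow 2).const_mul 2).div
      (hasDerivAt_pow 2 y) (by positivity))).congr_deriv ?_
    simp only [Pi.pow_apply]
    field_simp
    ring
  · have := H.four_sq_mul_nonneg hy
    have := neg_nonneg.2 (H.four_flux_nonpos hy)
    have : 0 < y := by linarith
    positivity
  · simpa using H.four_flux_tendsto_zero.neg.sub (H.four_tendsto_pow_div 2 (n := 2))

/-- The cubic term compensates for the decrease of `m`: after adding it, the derivative is a sum of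
two nonpositive terms, one of them by `four_neg_flux_le`. -/
theorem four_le_neg_flux (H : IsFluxPair 4 u h) {r : ℝ} (hr : 1 < r) :
    0 ≤ -h r - 2 * (r ^ 2 * u r) ^ 2 / r ^ 2 + 4 * (r ^ 2 * u r) ^ 3 / r ^ 2 := by
  refine nonneg_of_hasDerivAt_nonpos_of_tendsto
    (f := fun r => -h r - 2 * (r ^ 2 * u r) ^ 2 / r ^ 2 + 4 * (r ^ 2 * u r) ^ 3 / r ^ 2)
    (f' := fun r => 4 * (r ^ 2 * u r) / r * (-h r - 2 * (r ^ 2 * u r) ^ 2 / r ^ 2) +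
      12 * (r ^ 2 * u r) ^ 2 / r * h r) (a := 1)
    (fun y hy => ?_) (fun y hy => ?_) ?_ hr
  · have hy0 : y ≠ 0 := by positivity
    refine (((H.hasDerivAt_flux y hy).neg.sub
      ((((H.four_hasDerivAt_sq_mul hy).pow 2).const_mul 2).div
      (hasDerivAt_pow 2 y) (by positivity))).add
      ((((H.four_hasDerivAt_sq_mul hy).pow 3).const_mul 4).div
      (hasDerivAt_pow 2 y) (by positivity))).congr_deriv ?_
    simp only [Pi.pow_apply]
    field_simp
    ring
  · have h1 := H.four_sq_mul_nonneg hy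
    have hy0 : 0 < y := by linarith
    exact add_nonpos
      (mul_nonpos_of_nonneg_of_nonpos (by positivity) (H.four_neg_flux_le hy))
      (mul_nonpos_of_nonneg_of_nonpos (by positivity) (H.four_flux_nonpos hy))
  · simpa using (H.four_flux_tendsto_zero.neg.sub (H.four_tendsto_pow_div 2 (n := 2))).add
      (H.four_tendsto_pow_div 4 (n := 3))

theorem four_hasDerivAt_inv (H : IsFluxPair 4 u h) {r : ℝ} (hr : 1 < r) (hu : 0 < u r) :
    HasDerivAt (fun r => (r ^ 2 * u r)⁻¹) (-(r * h r) / (r ^ 2 * u r) ^ 2) r :=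
  (H.four_hasDerivAt_sq_mul hr).inv (by positivity)

theorem four_le_deriv_inv (H : IsFluxPair 4 u h) {r : ℝ} (hr : 1 < r) (hu : 0 < u r) :
    (2 - 4 * (r ^ 2 * u r)) / r ≤ -(r * h r) / (r ^ 2 * u r) ^ 2 := by
  have hr0 : 0 < r := by linarith
  have h1 := mul_nonneg (show 0 ≤ r / (r ^ 2 * u r) ^ 2 by positivity) (H.four_le_neg_flux hr)
  have e : r / (r ^ 2 * u r) ^ 2 *
      (-h r - 2 * (r ^ 2 * u r) ^ 2 / r ^ 2 + 4 * (r ^ 2 * u r) ^ 3 / r ^ 2) =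
      -(r * h r) / (r ^ 2 * u r) ^ 2 - (2 - 4 * (r ^ 2 * u r)) / r := by
    field_simp
    ring
  rw [e] at h1
  linarith

/-- First upper estimate in dimension four, up to a constant factor. -/
theorem four_eventually_le_two_div_log (H : IsFluxPair 4 u h) (hpos : ∀ r, 1 < r → 0 < u r) :
    ∀ᶠ r in atTop, r ^ 2 * u r ≤ 2 / Real.log r := by
  obtain ⟨b, hb⟩ := eventually_atTop.1
    ((H.four_tendsto_sq_mul.eventually_le_const (show (0 : ℝ) < 1 / 4 by norm_num)).and
      (eventually_gt_atTop 1))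
  have hmono : MonotoneOn (fun r => (r ^ 2 * u r)⁻¹ - Real.log r) (Ioi b) := by
    refine monotoneOn_Ioi_of_hasDerivAt_nonneg
      (f' := fun r => -(r * h r) / (r ^ 2 * u r) ^ 2 - r⁻¹) (fun r hr => ?_) (fun r hr => ?_)
    · have hr1 := (hb r hr.le).2
      exact (H.four_hasDerivAt_inv hr1 (hpos r hr1)).sub (Real.hasDerivAt_log (by positivity))
    · obtain ⟨h4, hr1⟩ := hb r hr.le
      have h1 := H.four_le_deriv_inv hr1 (hpos r hr1)
      have h2 : r⁻¹ ≤ (2 - 4 * (r ^ 2 * u r)) / r := by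
        rw [inv_eq_one_div]
        gcongr
        linarith
      linarith
  set C := ((b + 1) ^ 2 * u (b + 1))⁻¹ - Real.log (b + 1) with hC
  filter_upwards [eventually_ge_atTop (b + 1), eventually_gt_atTop 1,
    Real.tendsto_log_atTop.eventually_ge_atTop (-2 * C),
    Real.tendsto_log_atTop.eventually_gt_atTop 0] with r hr hr1 hlog hlog0
  have h1 := hmono (show b < b + 1 by linarith) (show b < r by linarith) hr
  simp only [← hC] at h1
  have hm : 0 < r ^ 2 * u r := mul_pos (by positivity) (hpos r hr1)
  have h2 : Real.log r / 2 ≤ (r ^ 2 * u r)⁻¹ := by linarith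
  rw [le_inv_comm₀ (by positivity) hm] at h2
  refine h2.trans_eq ?_
  rw [inv_div]

/-- Sharp upper estimate in dimension four. -/
theorem four_eventually_le (H : IsFluxPair 4 u h) (hpos : ∀ r, 1 < r → 0 < u r) :
    ∃ C, 0 < C ∧ ∀ᶠ r in atTop, r ^ 2 * u r ≤
      1 / (2 * Real.log r) + C * Real.log (Real.log r) / Real.log r ^ 2 := by
  obtain ⟨b, hb⟩ := eventually_atTop.1 (((H.four_eventually_le_two_div_log hpos).and
    (eventually_gt_atTop 1)).and (Real.tendsto_log_atTop.eventually_gt_atTop 0))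
  have hmono : MonotoneOn
      (fun r => (r ^ 2 * u r)⁻¹ - (2 * Real.log r - 8 * Real.log (Real.log r))) (Ioi b) := by
    refine monotoneOn_Ioi_of_hasDerivAt_nonneg
      (f' := fun r => -(r * h r) / (r ^ 2 * u r) ^ 2 - (2 * r⁻¹ - 8 * (r⁻¹ / Real.log r)))
      (fun r hr => ?_) (fun r hr => ?_)
    · obtain ⟨⟨_, hr1⟩, hl⟩ := hb r hr.le
      have hL := Real.hasDerivAt_log (show r ≠ 0 by positivity)
      exact (H.four_hasDerivAt_inv hr1 (hpos r hr1)).sub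
        ((hL.const_mul 2).sub ((hL.log hl.ne').const_mul 8))
    · obtain ⟨⟨h4, hr1⟩, hl⟩ := hb r hr.le
      have hr0 : 0 < r := by linarith
      have h1 := H.four_le_deriv_inv hr1 (hpos r hr1)
      -- The crude bound `m ≤ 2 / log r` is inserted into `(2 - 4 m) / r`; the error integrates to
      -- `8 log log r`.
      have h2 : 2 * r⁻¹ - 8 * (r⁻¹ / Real.log r) ≤ (2 - 4 * (r ^ 2 * u r)) / r := by
        have e : 2 * r⁻¹ - 8 * (r⁻¹ / Real.log r) = (2 - 4 * (2 / Real.log r)) / r := by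
          field_simp
          ring
        rw [e]
        gcongr
      linarith
  set K := ((b + 1) ^ 2 * u (b + 1))⁻¹ -
    (2 * Real.log (b + 1) - 8 * Real.log (Real.log (b + 1))) with hK
  have hloglog := Real.tendsto_log_atTop.comp Real.tendsto_log_atTop
  have hsmall : ∀ᶠ t : ℝ in atTop, Real.log t ≤ 1 / (8 + |K|) * t := by
    have h1 := Real.isLittleO_log_id_atTop.bound (show 0 < 1 / (8 + |K|) by positivity)
    filter_upwards [h1, eventually_ge_atTop 0] with t ht ht0
    simp only [id, Real.norm_eq_abs, abs_of_nonneg ht0] at ht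
    exact (le_abs_self _).trans ht
  refine ⟨(8 + |K|) / 2, by positivity, ?_⟩
  filter_upwards [eventually_ge_atTop (b + 1), eventually_gt_atTop 1,
    hloglog.eventually_ge_atTop 1, Real.tendsto_log_atTop.eventually hsmall,
    Real.tendsto_log_atTop.eventually_gt_atTop 0] with r hr hr1 hll hs hl
  simp only [Function.comp_apply] at hll
  have h1 := hmono (show b < b + 1 by linarith) (show b < r by linarith) hr
  simp only [← hK] at h1
  have hm : 0 < r ^ 2 * u r := mul_pos (by positivity) (hpos r hr1)
  set t := Real.log r with ht
  -- Absorbs the constant of integration into the double logarithm, using `log t ≥ 1`. The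
  -- reciprocal is then inverted by `1/(2t - s) ≤ 1/(2t) + s/(2t²)`, valid for `0 ≤ s ≤ t`.
  set s := (8 + |K|) * Real.log t with hs'
  have hst : s ≤ t := by
    have := mul_le_mul_of_nonneg_left hs (show 0 ≤ 8 + |K| by positivity)
    have e : (8 + |K|) * (1 / (8 + |K|) * t) = t := by field_simp
    linarith
  have hs0 : 0 ≤ s := by positivity
  have hK2 : -K ≤ |K| * Real.log t := by
    have := mul_le_mul_of_nonneg_left hll (abs_nonneg K)
    linarith [neg_abs_le K]
  have h2 : 2 * t - s ≤ (r ^ 2 * u r)⁻¹ := by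
    rw [hs']
    linarith
  rw [le_inv_comm₀ (by linarith) hm] at h2
  refine h2.trans ?_
  have e : (8 + |K|) / 2 * Real.log t / t ^ 2 = s / (2 * t ^ 2) := by
    rw [hs']
    field_simp
  rw [e, inv_eq_one_div, div_le_iff₀ (by linarith)]
  have e2 : (1 / (2 * t) + s / (2 * t ^ 2)) * (2 * t - s) =
      1 + s * (t - s) / (2 * t ^ 2) := by
    field_simp
    ring
  rw [e2]
  have : 0 ≤ s * (t - s) / (2 * t ^ 2) :=
    div_nonneg (mul_nonneg hs0 (sub_nonneg.2 hst)) (by positivity)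
  linarith

end IsFluxPair

/-! ### Limit and uniform bounds in dimension four -/

theorem IsMaximalNonnegSolution.tendsto_four {u : ℝ → ℝ} (hu : IsMaximalNonnegSolution 4 u) :
    Tendsto (fun r : ℝ => r ^ 2 * Real.log r * u r) atTop (𝓝 (1 / 2)) := by
  obtain ⟨C, hC, hle⟩ := hu.isNonnegSolution.isFluxPair.four_eventually_le
    fun r hr => hu.pos le_rfl hr
  have hlog := Real.tendsto_log_atTop
  have hupper : Tendsto (fun t : ℝ => 1 / 2 + C * (Real.log t / t)) atTop (𝓝 (1 / 2)) := by
    have h1 : Tendsto (fun t : ℝ => Real.log t / t) atTop (𝓝 0) :=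
      Real.isLittleO_log_id_atTop.tendsto_div_nhds_zero
    simpa only [mul_zero, add_zero] using (h1.const_mul C).const_add (1 / 2)
  have hlower : Tendsto (fun t : ℝ => 1 / 2 * (1 - Real.log 2 / (Real.log 2 + t))) atTop
      (𝓝 (1 / 2)) := by
    have h1 : Tendsto (fun t : ℝ => Real.log 2 / (Real.log 2 + t)) atTop (𝓝 0) :=
      tendsto_const_nhds.div_atTop (tendsto_atTop_add_const_left _ _ tendsto_id)
    simpa only [sub_zero, mul_one] using (h1.const_sub 1).const_mul (1 / 2)
  refine tendsto_of_tendsto_of_tendsto_of_le_of_le' (hlower.comp hlog) (hupper.comp hlog) ?_ ?_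
  · filter_upwards [eventually_gt_atTop 1] with r hr
    have hr0 : 0 < r := by linarith
    have hl : 0 < Real.log r := Real.log_pos hr
    have hl2 : 0 < Real.log 2 := Real.log_pos (by norm_num)
    have h1 := mul_le_mul_of_nonneg_left (hu.four_ge hr)
      (show 0 ≤ r ^ 2 * Real.log r by positivity)
    rw [Real.log_mul two_ne_zero hr0.ne'] at h1
    refine le_trans (le_of_eq ?_) h1
    simp only [Function.comp_apply]
    have : Real.log 2 + Real.log r ≠ 0 := by positivity
    field_simp
    ring
  · filter_upwards [hle, eventually_gt_atTop 1] with r h1 hr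
    have hl : 0 < Real.log r := Real.log_pos hr
    have h2 := mul_le_mul_of_nonneg_left h1 hl.le
    simp only [Function.comp_apply]
    calc r ^ 2 * Real.log r * u r = Real.log r * (r ^ 2 * u r) := by ring
      _ ≤ _ := h2
      _ = _ := by field_simp

theorem IsMaximalNonnegSolution.le_four :
    ∃ b₀ : ℝ, 0 < b₀ ∧ ∀ u : ℝ → ℝ, IsMaximalNonnegSolution 4 u →
      ∀ r : ℝ, 4 / 3 ≤ r → u r ≤ b₀ * (2 * r ^ 2 * Real.log r)⁻¹ := by
  obtain ⟨w, hw⟩ := exists_isMaximalNonnegSolution (d := 4) (by norm_num)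
  have H := hw.isNonnegSolution.isFluxPair
  obtain ⟨R, hR⟩ := eventually_atTop.1
    (hw.tendsto_four.eventually_le_const (show (1 / 2 : ℝ) < 1 by norm_num))
  have h43 : (1 : ℝ) < 4 / 3 := by norm_num
  set M := (4 / 3 : ℝ) ^ 2 * w (4 / 3) with hM
  have hM0 : 0 < M := mul_pos (by norm_num) (hw.pos le_rfl h43)
  -- The `2` handles `r ≥ R`, where `r² log r · w ≤ 1`; the other term handles `r < R`, where `r² w
  -- ≤ M` by monotonicity.
  refine ⟨2 + 2 * M * |Real.log R|, by positivity, fun u hu r hr => ?_⟩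
  have hr1 : 1 < r := by linarith
  have hl : 0 < Real.log r := Real.log_pos hr1
  rw [hu.eq hw hr1, ← div_eq_mul_inv, le_div_iff₀ (by positivity)]
  rcases le_or_gt R r with h | h
  · have h1 := hR r h
    have h2 : 0 ≤ 2 * M * |Real.log R| := by positivity
    linarith
  · have h1 : r ^ 2 * w r ≤ M := H.four_antitoneOn_sq_mul h43 hr1 hr
    have h2 : Real.log r ≤ |Real.log R| :=
      (Real.log_le_log (by linarith) h.le).trans (le_abs_self _)
    have h3 := mul_le_mul h1 h2 hl.le hM0.le
    linarith

theorem IsMaximalNonnegSolution.le_four_sharp {ρ : ℝ} (hρ : Real.exp 1 < ρ) :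
    ∃ b₁ : ℝ, 0 < b₁ ∧ ∀ u : ℝ → ℝ, IsMaximalNonnegSolution 4 u → ∀ r : ℝ, ρ ≤ r →
      u r ≤ 1 / 2 * (r ^ 2)⁻¹ * (Real.log r)⁻¹ +
        b₁ * (r ^ 2)⁻¹ * ((Real.log r) ^ 2)⁻¹ * Real.log (Real.log r) := by
  obtain ⟨w, hw⟩ := exists_isMaximalNonnegSolution (d := 4) (by norm_num)
  have H := hw.isNonnegSolution.isFluxPair
  obtain ⟨C, hC, hle⟩ := H.four_eventually_le fun r hr => hw.pos le_rfl hr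
  obtain ⟨R, hR⟩ := eventually_atTop.1 hle
  have hρ1 : 1 < ρ := (Real.one_lt_exp_iff.2 one_pos).trans hρ
  have hlogρ : 1 < Real.log ρ := by rwa [Real.lt_log_iff_exp_lt (by linarith)]
  have hllρ : 0 < Real.log (Real.log ρ) := Real.log_pos hlogρ
  set M := ρ ^ 2 * w ρ with hM
  have hM0 : 0 < M := mul_pos (by positivity) (hw.pos le_rfl hρ1)
  -- Chosen so that the correction term alone exceeds `M` on `[ρ, R)`; `ρ > e` is what makes `log
  -- (log ρ)` positive.
  set K := M * Real.log R ^ 2 / Real.log (Real.log ρ) with hK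
  have hK0 : 0 ≤ K := by positivity
  refine ⟨C + K, by positivity, fun u hu r hr => ?_⟩
  have hr1 : 1 < r := by linarith
  have hl : 1 < Real.log r := hlogρ.trans_le (Real.log_le_log (by linarith) hr)
  have hll : Real.log (Real.log ρ) ≤ Real.log (Real.log r) :=
    Real.log_le_log (by linarith) (Real.log_le_log (by linarith) hr)
  have hll0 : 0 < Real.log (Real.log r) := hllρ.trans_le hll
  have key : r ^ 2 * w r ≤ 1 / (2 * Real.log r) +
      (C + K) * Real.log (Real.log r) / Real.log r ^ 2 := by
    have e : (C + K) * Real.log (Real.log r) / Real.log r ^ 2 =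
        C * Real.log (Real.log r) / Real.log r ^ 2 +
          K * Real.log (Real.log r) / Real.log r ^ 2 := by ring
    rw [e]
    have h0 : 0 ≤ C * Real.log (Real.log r) / Real.log r ^ 2 := by positivity
    have h0' : 0 ≤ K * Real.log (Real.log r) / Real.log r ^ 2 := by positivity
    have h0'' : 0 ≤ 1 / (2 * Real.log r) := by positivity
    rcases le_or_gt R r with h | h
    · linarith [hR r h]
    · have h1 : r ^ 2 * w r ≤ M := H.four_antitoneOn_sq_mul hρ1 hr1 hr
      have h2 : Real.log r ≤ Real.log R := Real.log_le_log (by linarith) h.le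
      have h3 : M ≤ K * Real.log (Real.log r) / Real.log r ^ 2 := by
        rw [le_div_iff₀ (by positivity)]
        calc M * Real.log r ^ 2 ≤ M * Real.log R ^ 2 := by gcongr
          _ = K * Real.log (Real.log ρ) := by rw [hK]; field_simp
          _ ≤ K * Real.log (Real.log r) := by gcongr
      linarith
  rw [hu.eq hw hr1]
  have e : w r = (r ^ 2)⁻¹ * (r ^ 2 * w r) := by field_simp
  rw [e]
  refine (mul_le_mul_of_nonneg_left key (by positivity)).trans_eq ?_
  field_simp

theorem mainTheorem7 :
    -- the maximal nonnegative solution exists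
    (∀ d : ℕ, 4 ≤ d → ∃ u : ℝ → ℝ, IsMaximalNonnegSolution d u) ∧
    -- dimension at least five
    (∀ d : ℕ, 5 ≤ d → ∃ a₀ b₀ b₁ : ℝ, 0 < a₀ ∧ 0 < b₀ ∧ 0 < b₁ ∧
      ∀ u : ℝ → ℝ, IsMaximalNonnegSolution d u →
        Tendsto (fun r : ℝ => r ^ ((d : ℤ) - 2) * u r) atTop (𝓝 a₀) ∧
        (∀ r : ℝ, 1 < r → a₀ * r ^ (2 - (d : ℤ)) ≤ u r) ∧
        (∀ r : ℝ, 4 / 3 ≤ r → u r ≤ b₀ * r ^ (2 - (d : ℤ))) ∧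
        (∀ r : ℝ, 4 / 3 ≤ r →
          u r ≤ a₀ * r ^ (2 - (d : ℤ)) + b₁ * r ^ (6 - 2 * (d : ℤ)))) ∧
    -- dimension four, where the limit constant is `1 / 2`
    ((∃ b₀ : ℝ, 0 < b₀ ∧
      ∀ u : ℝ → ℝ, IsMaximalNonnegSolution 4 u →
        Tendsto (fun r : ℝ => r ^ 2 * Real.log r * u r) atTop (𝓝 (1 / 2)) ∧
        (∀ r : ℝ, 1 < r → 1 / 2 * (r ^ 2)⁻¹ * (Real.log (2 * r))⁻¹ ≤ u r) ∧
        (∀ r : ℝ, 4 / 3 ≤ r → u r ≤ b₀ * (2 * r ^ 2 * Real.log r)⁻¹)) ∧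
     (∀ ρ : ℝ, Real.exp 1 < ρ → ∃ b₁ : ℝ, 0 < b₁ ∧
      ∀ u : ℝ → ℝ, IsMaximalNonnegSolution 4 u → ∀ r : ℝ, ρ ≤ r →
        u r ≤ 1 / 2 * (r ^ 2)⁻¹ * (Real.log r)⁻¹ +
          b₁ * (r ^ 2)⁻¹ * ((Real.log r) ^ 2)⁻¹ * Real.log (Real.log r))) := by
  refine ⟨fun d hd => exists_isMaximalNonnegSolution (by omega),
    fun d hd => IsMaximalNonnegSolution.asymptotics_of_five_le hd, ?_,
    fun ρ hρ => IsMaximalNonnegSolution.le_four_sharp hρ⟩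
  obtain ⟨b₀, hb₀, hle⟩ := IsMaximalNonnegSolution.le_four
  exact ⟨b₀, hb₀, fun u hu => ⟨hu.tendsto_four, fun r hr => hu.four_ge hr, hle u hu⟩⟩
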